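/- Let $n\ge 0$, let $\mathbb K=\mathbb R$ or $\mathbb C$, and let $(T,\tau)$, $T=(t_{kl})$, be the coordinates on $\mathrm{Symm}(n,\mathbb K)\times\mathbb K^n$, where $\mathrm{Symm}(n,\mathbb K)$ is the space of symmetric matrices of order $n$. The determinantal system $\mathfrak D_{flat}$ for a function $G(T,\tau)$ consists of the equations $DG=0$, where $D$ ranges over all $3\times 3$ minors of the symmetric $(n+1)\times(n+1)$ matrix of differential operators with entries $2\,\partial/\partial t_{kk}$ at $(k,k)$, $\partial/\partial t_{kl}$ at $(k,l)$ for $k\ne l$, $\partial/\partial\tau_k$ at $(k,n+1)$ and $(n+1,k)$ $(k,l\le n)$, and $0$ at $(n+1,n+1)$. Let $\mathrm{ASp}(2n,\mathbb K)$ be the group of matrices $$g=\begin{pmatrix}a&b&r\\c&d&s\\0&0&1\end{pmatrix},\qquad \begin{pmatrix}a&b\\c&d\end{pmatrix}\in\mathrm{Sp}(2n,\mathbb K),\quad r,s\in\mathbb K^n,$$ and write, where $\det(cT+d)\neq0$, $$g\cdot(T,\tau)=\bigl((aT+b)(cT+d)^{-1},\ a\tau+r-(aT+b)(cT+d)^{-1}(c\tau+s)\bigr).$$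 **(a)** Let $g\in\mathrm{ASp}(2n,\mathbb C)$, and let $G$ be a holomorphic solution of the determinantal system on an open set $\mathcal U\subset\mathrm{Symm}(n,\mathbb C)\times\mathbb C^n$. Then $\mathcal U_g=\{(T,\tau):\det(cT+d)\ne0,\ g\cdot(T,\tau)\in\mathcal U\}$ is open, and the function $$(T,\tau)\mapsto G\bigl(g\cdot(T,\tau)\bigr)\det(cT+d)^{-1}$$ is a holomorphic solution of the determinantal system on $\mathcal U_g$. **(b)** Let $g\in\mathrm{ASp}(2n,\mathbb R)$, and let $G$ be a smooth (real- or complex-valued) solution of the determinantal system on an open set $\mathcal U\subset\mathrm{Symm}(n,\mathbb R)\times\mathbb R^n$. Then $\mathcal U_g$, defined as in (a), is open, and both functions $$G\bigl(g\cdot(T,\tau)\bigr)\det(cT+d)^{-1},\qquad \rho_{flat}(g)G(T,\tau)=G\bigl(g\cdot(T,\tau)\bigr)\,|\det(cT+d)|^{-1}$$ are smooth solutions of the determinantal system on $\mathcal U_g$. **(c)** Let $\mathcal M=\{(S,\sigma)\in\mathrm{Symm}(n,\mathbb C)\times\mathbb C^n: SS^*=1,\ \sigma=-S\overline\sigma\}$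 (the compact model of the real affine Lagrangian Grassmannian, fibred over the symmetric unitary matrices with fibre $\mathbb R^n$). A holomorphic function $G$ on an open subset of $\{(S,\sigma):\det S\neq0\}\subset\mathrm{Symm}(n,\mathbb C)\times\mathbb C^n$ satisfies the system $\mathfrak D_{comp}$ if the two-valued function $\det(S)^{-1/2}G(S,\sigma)$ (that is, each of its local holomorphic branches) satisfies the determinantal system $\mathfrak D_{flat}$. Realize $\mathrm{ASp}(2n,\mathbb R)$ as the group of matrices $$g=\begin{pmatrix}\Phi&\Psi&p\\\overline\Psi&\overline\Phi&\overline p\\0&0&1\end{pmatrix}\in\mathrm{ASp}(2n,\mathbb C),$$ which acts on $\mathcal M$ by $(S,\sigma)\mapsto g\cdot(S,\sigma)$. Let $f$ be a complex-valued real analytic function on an open subset $\Omega$ of $\mathcal M$ (i.e. a function that has a holomorphic continuation to a neighbourhood of $\Omega$ in $\mathrm{Symm}(n,\mathbb C)\times\mathbb C^n$) whose holomorphic continuation satisfies $\mathfrak D_{comp}$ in a neighbourhood of $\Omega$. Then the function $$\rho_{comp}(g)f(S,\sigma)=f\bigl(g\cdot(S,\sigma)\bigr)\,\bigl|\det(\overline\Psi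 S+\overline\Phi)\bigr|^{-1}$$ on the open set $\Omega_g=\{(S,\sigma)\in\mathcal M: g\cdot(S,\sigma)\in\Omega\}$ of $\mathcal M$ has a holomorphic continuation to a neighbourhood of $\Omega_g$, and this continuation satisfies $\mathfrak D_{comp}$ in a neighbourhood of $\Omega_g$. -/

import Mathlib

open scoped Matrix ContDiff

attribute [local instance] Matrix.normedAddCommGroup Matrix.normedSpace

/-- `Symm(n, R)`: the symmetric matrices of order `n`. -/
def SymmMat (n : ℕ) (R : Type*) [CommRing R] : Submodule R (Matrix (Fin n) (Fin n) R) where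
  carrier := {T | T.IsSymm}
  add_mem' hA hB := Matrix.IsSymm.add hA hB
  zero_mem' := Matrix.isSymm_zero
  smul_mem' k _ hA := Matrix.IsSymm.smul hA k

/-- `Symm(n, R) × Rⁿ`: the coordinates `(T, τ)` of the affine Lagrangian subspace `x = T y + τ`. -/
abbrev SymmAff (n : ℕ) (R : Type*) [CommRing R] : Type _ := SymmMat n R × (Fin n → R)

/-- The affine symplectic group `ASp(2n, R)`: the matrices with rows `(a, b, r)`, `(c, d, s)`,
`(0, 0, 1)` of size `n + n + 1` whose linear part, with rows `(a, b)` and `(c, d)`, is symplectic. -/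
structure AffSymp (n : ℕ) (R : Type*) [CommRing R] where
  a : Matrix (Fin n) (Fin n) R
  b : Matrix (Fin n) (Fin n) R
  c : Matrix (Fin n) (Fin n) R
  d : Matrix (Fin n) (Fin n) R
  r : Fin n → R
  s : Fin n → R
  symplectic : Matrix.fromBlocks a b c d ∈ Matrix.symplecticGroup (Fin n) R

namespace AffSymp

variable {n : ℕ} {R : Type*} [CommRing R]

/-- The matrix `(aT + b)(cT + d)⁻¹`. -/
noncomputable def moebius (g : AffSymp n R) (T : Matrix (Fin n) (Fin n) R) :
    Matrix (Fin n) (Fin n) R :=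
  (g.a * T + g.b) * (g.c * T + g.d)⁻¹

theorem moebius_isSymm (g : AffSymp n R) {T : Matrix (Fin n) (Fin n) R} (hT : T.IsSymm) :
    (g.moebius T).IsSymm := by
  have h := SymplecticGroup.mem_iff'.1 g.symplectic
  simp only [Matrix.J, Matrix.fromBlocks_transpose, Matrix.fromBlocks_multiply,
    Matrix.fromBlocks_inj] at h
  obtain ⟨h1, h2, -, h4⟩ := h
  simp only [mul_zero, mul_one, mul_neg, zero_add, add_zero, neg_mul] at h1 h2 h4
  by_cases hN : IsUnit (g.c * T + g.d).det
  · have key : (g.c * T + g.d)ᵀ * (g.a * T + g.b) = (g.a * T + g.b)ᵀ * (g.c * T + g.d) := by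
      have h2' := congrArg Matrix.transpose h2
      simp only [Matrix.transpose_add, Matrix.transpose_mul, Matrix.transpose_neg,
        Matrix.transpose_transpose, Matrix.transpose_one] at h2'
      have e : g.cᵀ * g.a = g.aᵀ * g.c := by
        rw [← sub_eq_zero, sub_eq_add_neg]; exact h1
      have f : g.dᵀ * g.b = g.bᵀ * g.d := by
        rw [← sub_eq_zero, sub_eq_add_neg]; exact h4
      have k : g.cᵀ * g.b = g.aᵀ * g.d - 1 := by
        rw [eq_sub_iff_add_eq, ← sub_eq_zero]
        rw [← sub_eq_zero] at h2
        rw [← h2]; abel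
      have k' : g.dᵀ * g.a = g.bᵀ * g.c + 1 := by
        rw [← sub_eq_zero]
        rw [← sub_eq_zero] at h2'
        rw [← neg_eq_zero, ← h2']; abel
      have expL : (g.c * T + g.d)ᵀ * (g.a * T + g.b)
          = T * (g.cᵀ * g.a) * T + T * (g.cᵀ * g.b) + (g.dᵀ * g.a) * T + g.dᵀ * g.b := by
        rw [Matrix.transpose_add, Matrix.transpose_mul, hT.eq]; noncomm_ring
      have expR : (g.a * T + g.b)ᵀ * (g.c * T + g.d)
          = T * (g.aᵀ * g.c) * T + T * (g.aᵀ * g.d) + (g.bᵀ * g.c) * T + g.bᵀ * g.d := by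
        rw [Matrix.transpose_add, Matrix.transpose_mul, hT.eq]; noncomm_ring
      rw [expL, expR, e, f, k, k']; noncomm_ring
    have hNt : IsUnit ((g.c * T + g.d)ᵀ).det := by rwa [Matrix.det_transpose]
    unfold Matrix.IsSymm moebius
    rw [Matrix.transpose_mul, Matrix.transpose_nonsing_inv]
    calc ((g.c * T + g.d)ᵀ)⁻¹ * (g.a * T + g.b)ᵀ
        = ((g.c * T + g.d)ᵀ)⁻¹ * ((g.a * T + g.b)ᵀ * (g.c * T + g.d)) * (g.c * T + g.d)⁻¹ := by
          rw [mul_assoc, mul_assoc, Matrix.mul_nonsing_inv _ hN, mul_one]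
      _ = (g.a * T + g.b) * (g.c * T + g.d)⁻¹ := by
          rw [← key, ← mul_assoc, Matrix.nonsing_inv_mul _ hNt, one_mul]
  · unfold Matrix.IsSymm moebius
    rw [Matrix.nonsing_inv_apply_not_isUnit _ hN]; simp

/-- The (partially defined) action
`(T, τ) ↦ ((aT + b)(cT + d)⁻¹, aτ + r - (aT + b)(cT + d)⁻¹(cτ + s))`;
it is meaningful where `cT + d` is invertible. -/
noncomputable def act (g : AffSymp n R) (x : SymmAff n R) : SymmAff n R :=
  (⟨g.moebius x.1, g.moebius_isSymm x.1.2⟩,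
    g.a *ᵥ x.2 + g.r - g.moebius x.1 *ᵥ (g.c *ᵥ x.2 + g.s))

/-- `det(cT + d)`. -/
def autDet (g : AffSymp n R) (x : SymmAff n R) : R :=
  (g.c * (x.1 : Matrix (Fin n) (Fin n) R) + g.d).det

/-- The points that the action is defined at and carries into `U`. -/
def domain (g : AffSymp n R) (U : Set (SymmAff n R)) : Set (SymmAff n R) :=
  {x | g.autDet x ≠ 0 ∧ g.act x ∈ U}

/-- The function `(T, τ) ↦ det(cT + d)⁻¹ · G(g (T, τ))`. -/
noncomputable def transform {𝕜 E : Type*} [Field 𝕜] [AddCommGroup E] [Module 𝕜 E]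
    (g : AffSymp n 𝕜) (G : SymmAff n 𝕜 → E) : SymmAff n 𝕜 → E :=
  fun x => (g.autDet x)⁻¹ • G (g.act x)

/-- The transformation `ρ_flat`: the function `(T, τ) ↦ |det(cT + d)|⁻¹ · h(g (T, τ))`. -/
noncomputable def rhoFlat {E : Type*} [AddCommGroup E] [Module ℝ E]
    (g : AffSymp n ℝ) (h : SymmAff n ℝ → E) : SymmAff n ℝ → E :=
  fun x => |g.autDet x|⁻¹ • h (g.act x)

end AffSymp

section DeterminantalSystem

variable {n : ℕ} (𝕜 : Type*) [RCLike 𝕜] {E : Type*} [NormedAddCommGroup E] [NormedSpace 𝕜 E]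

/-- The direction of the coordinate `t_{kl} = t_{lk}` on symmetric matrices. -/
def symmDir (k l : Fin n) : SymmMat n 𝕜 :=
  ⟨if k = l then Matrix.single k k 1 else Matrix.single k l 1 + Matrix.single l k 1, by
    change Matrix.IsSymm _
    split_ifs
    · simp [Matrix.IsSymm]
    · simp [Matrix.IsSymm, add_comm]⟩

/-- `∂/∂t_{kl}`. -/
noncomputable def dT (k l : Fin n) (G : SymmAff n 𝕜 → E) : SymmAff n 𝕜 → E :=
  fun x => fderiv 𝕜 G x (symmDir 𝕜 k l, 0)

/-- `∂/∂τ_k`. -/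
noncomputable def dTau (k : Fin n) (G : SymmAff n 𝕜 → E) : SymmAff n 𝕜 → E :=
  fun x => fderiv 𝕜 G x (0, Pi.single k 1)

/-- The entries of the symmetric `(n+1) × (n+1)` matrix of differential operators: `2 ∂/∂t_{kk}` on
the diagonal of the first block, `∂/∂t_{kl}` off it, `∂/∂τ_k` in the last row and in the last
column, `0` in the corner. The last index is `Sum.inr ()`. -/
noncomputable def detEntry : Fin n ⊕ Unit → Fin n ⊕ Unit →
    (SymmAff n 𝕜 → E) → (SymmAff n 𝕜 → E)
  | .inl k, .inl l, G => if k = l then (2 : 𝕜) • dT 𝕜 k k G else dT 𝕜 k l G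
  | .inl k, .inr _, G => dTau 𝕜 k G
  | .inr _, .inl l, G => dTau 𝕜 l G
  | .inr _, .inr _, _ => 0

/-- The `3 × 3` minor of that matrix with rows `I` and columns `J`, as an operator on functions.
(The entries commute on smooth functions; reordering the rows or the columns only changes the
sign.) -/
noncomputable def detMinor (I J : Fin 3 ↪ Fin n ⊕ Unit) (G : SymmAff n 𝕜 → E) : SymmAff n 𝕜 → E :=
  ∑ π : Equiv.Perm (Fin 3), Equiv.Perm.sign π •
    detEntry 𝕜 (I (π 0)) (J 0) (detEntry 𝕜 (I (π 1)) (J 1) (detEntry 𝕜 (I (π 2)) (J 2) G))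

/-- `G` satisfies the determinantal system on `U`: all `3 × 3` minors annihilate it. -/
def SolvesDet (U : Set (SymmAff n 𝕜)) (G : SymmAff n 𝕜 → E) : Prop :=
  ∀ I J : Fin 3 ↪ Fin n ⊕ Unit, ∀ x ∈ U, detMinor 𝕜 I J G x = 0

end DeterminantalSystem

/-- `G` is a holomorphic solution of the determinantal system on the open set `U` (holomorphic in
several variables: a convergent power series near every point). -/
def IsHolSolution {n : ℕ} (U : Set (SymmAff n ℂ)) (G : SymmAff n ℂ → ℂ) : Prop :=
  IsOpen U ∧ AnalyticOnNhd ℂ G U ∧ SolvesDet ℂ U G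

/-- `G` is a smooth solution of the determinantal system on the open set `U` of real points. -/
def IsSmoothSolution {n : ℕ} {E : Type*} [NormedAddCommGroup E] [NormedSpace ℝ E]
    (U : Set (SymmAff n ℝ)) (G : SymmAff n ℝ → E) : Prop :=
  IsOpen U ∧ ContDiffOn ℝ ∞ G U ∧ SolvesDet ℝ U G

section CompactModel

/-- The complex realization of `ASp(2n, ℝ)`: matrices with rows `(Φ, Ψ, p)`, `(Φ', Ψ', p')`,
`(0, 0, 1)`, where `Φ'`, `Ψ'`, `p'` are the complex conjugates of `Ψ`, `Φ`, `p`, and the linear part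
is in `Sp(2n, ℂ)`. -/
structure AffSympComp (n : ℕ) where
  Φ : Matrix (Fin n) (Fin n) ℂ
  Ψ : Matrix (Fin n) (Fin n) ℂ
  p : Fin n → ℂ
  symplectic : Matrix.fromBlocks Φ Ψ (Ψ.map star) (Φ.map star) ∈ Matrix.symplecticGroup (Fin n) ℂ

/-- The inclusion of the complex realization into `ASp(2n, ℂ)`. -/
def AffSympComp.toAffSymp {n : ℕ} (g : AffSympComp n) : AffSymp n ℂ where
  a := g.Φ
  b := g.Ψ
  c := g.Ψ.map star
  d := g.Φ.map star
  r := g.p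
  s := star g.p
  symplectic := g.symplectic

/-- The compact model of the real affine Lagrangian Grassmannian: pairs `(S, σ)` with `S` symmetric
and unitary and `σ = -S σ'`, `σ'` being the complex conjugate of `σ`. -/
def compactModel (n : ℕ) : Set (SymmAff n ℂ) :=
  {x | (x.1 : Matrix (Fin n) (Fin n) ℂ) ∈ Matrix.unitaryGroup (Fin n) ℂ ∧
    x.2 = -((x.1 : Matrix (Fin n) (Fin n) ℂ) *ᵥ star x.2)}

variable {n : ℕ}

/-- The transformation `ρ_comp`: the function `(S, σ) ↦ f(g (S, σ)) · |det(Ψ' S + Φ')|⁻¹`, where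
`Ψ'` and `Φ'` are the complex conjugates of `Ψ` and `Φ`. -/
noncomputable def AffSympComp.rhoComp (g : AffSympComp n) (f : SymmAff n ℂ → ℂ) :
    SymmAff n ℂ → ℂ :=
  fun x => f (g.toAffSymp.act x) * ((‖g.toAffSymp.autDet x‖⁻¹ : ℝ) : ℂ)

/-- The system `𝔇_comp` on a set `O` where `det S ≠ 0`: the two-valued function
`det(S)^(-1/2) G(S, σ)` satisfies the determinantal system, that is, `φ G` satisfies it on `V` for
every holomorphic branch `φ` of `det(S)^(-1/2)` on an open subset `V` of `O`. -/
def SolvesComp (O : Set (SymmAff n ℂ)) (G : SymmAff n ℂ → ℂ) : Prop :=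
  (∀ x ∈ O, (x.1 : Matrix (Fin n) (Fin n) ℂ).det ≠ 0) ∧
  ∀ V ⊆ O, IsOpen V → ∀ φ : SymmAff n ℂ → ℂ, AnalyticOnNhd ℂ φ V →
    (∀ x ∈ V, φ x ^ 2 * (x.1 : Matrix (Fin n) (Fin n) ℂ).det = 1) →
    SolvesDet ℂ V (fun x => φ x * G x)

/-- `G` is a holomorphic continuation of `f`, given on a subset `Ω` of the compact model, to the
neighbourhood `O` of `Ω` in `Symm(n, ℂ) × ℂⁿ`. -/
def IsHolContinuation (Ω : Set (SymmAff n ℂ)) (f : SymmAff n ℂ → ℂ)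
    (O : Set (SymmAff n ℂ)) (G : SymmAff n ℂ → ℂ) : Prop :=
  IsOpen O ∧ Ω ⊆ O ∧ AnalyticOnNhd ℂ G O ∧ Set.EqOn G f Ω

/-- `Ω` is open in the compact model, `f` is real analytic on `Ω` (it has a holomorphic continuation
to a neighbourhood of `Ω`; the compact model is a totally real submanifold of maximal dimension), and
its holomorphic continuation satisfies `𝔇_comp` near `Ω`. Only the values of `f` on `Ω` matter. -/
def IsCompSolution (Ω : Set (SymmAff n ℂ)) (f : SymmAff n ℂ → ℂ) : Prop :=
  (∃ W, IsOpen W ∧ Ω = W ∩ compactModel n) ∧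
  (∃ O G, IsHolContinuation Ω f O G) ∧
  ∀ O G, IsHolContinuation Ω f O G → ∃ O' ⊆ O, IsOpen O' ∧ Ω ⊆ O' ∧ SolvesComp O' G

end CompactModel

/-! ### Antisymmetrized contractions of trilinear forms with symmetric products -/

section Contraction

variable {𝕜 E m : Type*} [Field 𝕜] [AddCommGroup E] [Module 𝕜 E]

/-! The flat system is covariant because of a pointwise fact about third-order jets. Identify
directions in Symm × 𝕜ⁿ with symmetric matrices of order n + 1 whose corner entry is ignored. The
operator at (k, l) is then the derivative along the symmetric product of the basis vectors e_k and
e_l, and a 3 × 3 minor is the third derivative contracted with the antisymmetrization in the u's of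
(u₀w₀)(u₁w₁)(u₂w₂) (`detEntry_eq_fderiv`, `detMinor_eq_minorContraction`). By multilinearity the
system says that this contraction vanishes for all vectors u, w
(`minorContraction_eq_zero_of_single`), a condition stable under congruences X ↦ PXPᵀ.

In the bordered model the affine action has an exact expansion: a displacement Z at x becomes the
displacement P Z(1 + CZ)⁻¹ Pᵀ at gx, and det(cT + d) is multiplied by det(1 + CZ), where C is the
symmetric matrix (cT + d)⁻¹c bordered by zeros (`act_add_blockProj`, `autDet_add_blockProj`). It
remains to see that the minors annihilate the third-order part of det(1 + CZ)⁻¹ H(Z(1 + CZ)⁻¹)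
whenever they annihilate that of H. The lower-order jets of H contribute terms that split into
groups, each annihilated on its own: a pairing of two u's is symmetric and dies, and the surviving
chains are carried by a cyclic permutation of the u's into products of traces, up to the sign of the
cycle. The exponent -1 of the determinant gives the traces exactly the coefficients that make this
cancel (`minorContraction_eq_zero_of_diagonal`).

Replacing det by |det| over ℝ only changes a locally constant sign. On the compact model S̄ = S⁻¹,
so |det(Ψ̄S + Φ̄)|² continues holomorphically to det(ΦS + Ψ) det(Ψ̄S + Φ̄)/det S. Its inverse square
root, combined with branches of det(S)^(-1/2) at S and at gS, reproduces det(Ψ̄S + Φ̄)⁻¹ up to a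
locally constant sign, so the flat covariance applies (`solvesComp_of_eventuallyEq_rhoCont`). An
arbitrary continuation agrees with this one near the model, because the model is a set of
uniqueness: a Cayley transform straightens it locally to the real points
(`eventually_eq_zero_of_eventually_mem_compactModel`). -/

/-- The symmetric product `u wᵀ + w uᵀ` of two vectors. -/
def symProd (u w : m → 𝕜) : Matrix m m 𝕜 :=
  Matrix.vecMulVec u w + Matrix.vecMulVec w u

theorem symProd_comm (u w : m → 𝕜) : symProd u w = symProd w u := add_comm _ _

theorem symProd_transpose (u w : m → 𝕜) : (symProd u w)ᵀ = symProd u w := by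
  simp [symProd, Matrix.transpose_vecMulVec, add_comm]

theorem symProd_add_left (u v w : m → 𝕜) : symProd (u + v) w = symProd u w + symProd v w := by
  simp only [symProd, Matrix.add_vecMulVec, Matrix.vecMulVec_add]; abel

theorem symProd_smul_left (a : 𝕜) (u w : m → 𝕜) : symProd (a • u) w = a • symProd u w := by
  simp only [symProd, Matrix.smul_vecMulVec, Matrix.vecMulVec_smul, smul_add]

/-- The contraction of a trilinear function with the antisymmetrization in `u₀, u₁, u₂` of the
product of the symmetric products of `uᵢ` and `wᵢ`. -/
def minorContraction (B : Matrix m m 𝕜 → Matrix m m 𝕜 → Matrix m m 𝕜 → E)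
    (u₀ u₁ u₂ w₀ w₁ w₂ : m → 𝕜) : E :=
  B (symProd u₀ w₀) (symProd u₁ w₁) (symProd u₂ w₂)
  + B (symProd u₁ w₀) (symProd u₂ w₁) (symProd u₀ w₂)
  + B (symProd u₂ w₀) (symProd u₀ w₁) (symProd u₁ w₂)
  - B (symProd u₁ w₀) (symProd u₀ w₁) (symProd u₂ w₂)
  - B (symProd u₀ w₀) (symProd u₂ w₁) (symProd u₁ w₂)
  - B (symProd u₂ w₀) (symProd u₁ w₁) (symProd u₀ w₂)

theorem sum_perm_fin_three {M : Type*} [AddCommGroup M] (f : Equiv.Perm (Fin 3) → M)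
    (F : Fin 3 → Fin 3 → Fin 3 → M) (hf : ∀ π, f π = F (π 0) (π 1) (π 2)) :
    ∑ π : Equiv.Perm (Fin 3), Equiv.Perm.sign π • f π =
      F 0 1 2 + F 1 2 0 + F 2 0 1 - F 1 0 2 - F 0 2 1 - F 2 1 0 := by
  simp only [hf]
  -- A permutation of three points is split into the image of 0 and a permutation of the remaining
  -- two.
  rw [← (Equiv.Perm.decomposeFin (n := 2)).symm.sum_comp, Fintype.sum_prod_type]
  have h2 : ∀ g : Equiv.Perm (Fin 2) → M, ∑ π, g π = g 1 + g (Equiv.swap 0 1) := by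
    intro g
    rw [show (Finset.univ : Finset (Equiv.Perm (Fin 2))) = {1, Equiv.swap 0 1} by decide,
      Finset.sum_pair (by decide)]
  simp only [Fin.sum_univ_three, h2]
  have e : ∀ (i : Fin 3) (σ : Equiv.Perm (Fin 2)),
      Equiv.Perm.sign (Equiv.Perm.decomposeFin.symm (i, σ)) =
        (if i = 0 then 1 else -1) * Equiv.Perm.sign σ := fun i σ =>
    Equiv.Perm.decomposeFin.symm_sign i σ
  simp only [e]
  have v : ∀ (i : Fin 3),
      (Equiv.Perm.decomposeFin.symm (i, (1 : Equiv.Perm (Fin 2)))) 0 = i ∧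
      (Equiv.Perm.decomposeFin.symm (i, (1 : Equiv.Perm (Fin 2)))) 1 = Equiv.swap 0 i 1 ∧
      (Equiv.Perm.decomposeFin.symm (i, (1 : Equiv.Perm (Fin 2)))) 2 = Equiv.swap 0 i 2 ∧
      (Equiv.Perm.decomposeFin.symm (i, (Equiv.swap 0 1 : Equiv.Perm (Fin 2)))) 0 = i ∧
      (Equiv.Perm.decomposeFin.symm (i, (Equiv.swap 0 1 : Equiv.Perm (Fin 2)))) 1
        = Equiv.swap 0 i 2 ∧
      (Equiv.Perm.decomposeFin.symm (i, (Equiv.swap 0 1 : Equiv.Perm (Fin 2)))) 2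
        = Equiv.swap 0 i 1 := by decide
  simp only [(v _).1, (v _).2.1, (v _).2.2.1, (v _).2.2.2.1, (v _).2.2.2.2.1, (v _).2.2.2.2.2]
  have s : Equiv.swap (0 : Fin 3) 0 1 = 1 ∧ Equiv.swap (0 : Fin 3) 0 2 = 2 ∧
    Equiv.swap (0 : Fin 3) 1 1 = 0 ∧ Equiv.swap (0 : Fin 3) 1 2 = 2 ∧
    Equiv.swap (0 : Fin 3) 2 1 = 1 ∧ Equiv.swap (0 : Fin 3) 2 2 = 0 := by decide
  have z : (1 : Fin 3) ≠ 0 ∧ (2 : Fin 3) ≠ 0 := by decide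
  simp only [s, z, if_true, if_false, Equiv.Perm.sign_one, Equiv.Perm.sign_swap
    (show (0 : Fin 2) ≠ 1 by decide), mul_one, mul_neg, neg_neg, one_smul, Units.neg_smul]
  abel

/-- If a triadditive function vanishes on the diagonal of a subgroup, then its symmetrization
vanishes there. -/
theorem sum_perm_eq_zero_of_diagonal {M N : Type*} [AddCommGroup M] [AddCommGroup N]
    (P : AddSubgroup M) (A : M → M → M → N)
    (h₀ : ∀ x y z w, A (x + y) z w = A x z w + A y z w)
    (h₁ : ∀ x y z w, A z (x + y) w = A z x w + A z y w)
    (h₂ : ∀ x y z w, A z w (x + y) = A z w x + A z w y)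
    (h : ∀ x ∈ P, A x x x = 0) {x y z : M} (hx : x ∈ P) (hy : y ∈ P) (hz : z ∈ P) :
    A x y z + A y z x + A z x y + A y x z + A x z y + A z y x = 0 := by
  have e1 := h _ (P.add_mem (P.add_mem hx hy) hz)
  have e2 := h _ (P.add_mem hx hy)
  have e3 := h _ (P.add_mem hx hz)
  have e4 := h _ (P.add_mem hy hz)
  simp only [h₀, h₁, h₂] at e1 e2 e3 e4
  have e5 := h _ hx
  have e6 := h _ hy
  have e7 := h _ hz
  -- Polarization by inclusion–exclusion over the nonempty subsets of {x, y, z}.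
  linear_combination (norm := module) e1 - e2 - e3 - e4 + e5 + e6 + e7

variable [Fintype m]

theorem vecMulVec_mul_mul_vecMulVec (C : Matrix m m 𝕜) (a b c d : m → 𝕜) :
    Matrix.vecMulVec a b * C * Matrix.vecMulVec c d = (b ⬝ᵥ C *ᵥ c) • Matrix.vecMulVec a d := by
  rw [Matrix.vecMulVec_mul, Matrix.vecMulVec_mul_vecMulVec, ← Matrix.dotProduct_mulVec,
    Matrix.vecMulVec_smul]

theorem trace_mul_vecMulVec (C : Matrix m m 𝕜) (a b : m → 𝕜) :
    (C * Matrix.vecMulVec a b).trace = b ⬝ᵥ C *ᵥ a := by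
  rw [Matrix.mul_vecMulVec, Matrix.trace_vecMulVec, dotProduct_comm]

end Contraction

/-! ### Lower-order terms annihilated by every minor -/

section ContractionIdentities

variable {𝕜 E m : Type*} [Field 𝕜] [AddCommGroup E] [Module 𝕜 E] [Fintype m]

theorem symProd_mul_mul_symProd (C : Matrix m m 𝕜) (u w u' w' : m → 𝕜) :
    symProd u w * C * symProd u' w' =
      (w ⬝ᵥ C *ᵥ u') • Matrix.vecMulVec u w' + (w ⬝ᵥ C *ᵥ w') • Matrix.vecMulVec u u' +
      (u ⬝ᵥ C *ᵥ u') • Matrix.vecMulVec w w' + (u ⬝ᵥ C *ᵥ w') • Matrix.vecMulVec w u' := by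
  simp only [symProd, add_mul, mul_add, vecMulVec_mul_mul_vecMulVec]
  abel

theorem dotProduct_mulVec_comm {C : Matrix m m 𝕜} (hC : C.IsSymm) (a b : m → 𝕜) :
    a ⬝ᵥ C *ᵥ b = b ⬝ᵥ C *ᵥ a := by
  rw [Matrix.dotProduct_mulVec, dotProduct_comm, ← Matrix.mulVec_transpose, hC.eq]

theorem trace_mul_symProd {C : Matrix m m 𝕜} (hC : C.IsSymm) (u w : m → 𝕜) :
    (C * symProd u w).trace = 2 * (u ⬝ᵥ C *ᵥ w) := by
  rw [symProd, mul_add, Matrix.trace_add, trace_mul_vecMulVec, trace_mul_vecMulVec,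
    dotProduct_mulVec_comm hC w u, two_mul]

theorem trace_mul_symProd_two {C : Matrix m m 𝕜} (hC : C.IsSymm) (u w u' w' : m → 𝕜) :
    (C * symProd u w * C * symProd u' w').trace =
      2 * ((u' ⬝ᵥ C *ᵥ w) * (u ⬝ᵥ C *ᵥ w') + (u ⬝ᵥ C *ᵥ u') * (w ⬝ᵥ C *ᵥ w')) := by
  rw [mul_assoc C, mul_assoc C, symProd_mul_mul_symProd]
  simp only [mul_add, Matrix.mul_smul, Matrix.trace_add, Matrix.trace_smul, trace_mul_vecMulVec,
    smul_eq_mul]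
  rw [dotProduct_mulVec_comm hC w' u, dotProduct_mulVec_comm hC w u',
    dotProduct_mulVec_comm hC u' u, dotProduct_mulVec_comm hC w' w]
  ring

/-- In the expansion of XCY, the term pairing u₀ with u₁ and the term feeding u₀u₁ᵀ to `H` are
symmetric under exchanging these two vectors, so they cancel. In the other two terms the same
exchange produces the trace terms with the opposite sign. The weight 4 against 1 and 1 compensates
the factors 2 in the trace and in `H` of a symmetric product. -/
theorem minorContraction_bilinear {C : Matrix m m 𝕜} (hC : C.IsSymm)
    (H : Matrix m m 𝕜 →ₗ[𝕜] Matrix m m 𝕜 →ₗ[𝕜] E) (hH : ∀ X Y, H Xᵀ Y = H X Y)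
    (hs : ∀ X Y, H X Y = H Y X) (u₀ u₁ u₂ w₀ w₁ w₂ : m → 𝕜) :
    minorContraction (fun X Y Z => (4 : 𝕜) • H (X * C * Y) Z +
      ((C * X).trace • H Y Z + (C * Y).trace • H X Z)) u₀ u₁ u₂ w₀ w₁ w₂ = 0 := by
  have hv : ∀ a b Y, H (Matrix.vecMulVec a b) Y = H (Matrix.vecMulVec b a) Y := fun a b Y => by
    rw [← hH, Matrix.transpose_vecMulVec]
  have hsym : ∀ a b Y, H (symProd a b) Y = (2 : 𝕜) • H (Matrix.vecMulVec a b) Y := fun a b Y => by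
    rw [symProd, map_add, LinearMap.add_apply, hv b a, two_smul]
  have hsym' : ∀ a b c d, H (Matrix.vecMulVec a b) (symProd c d) =
      (2 : 𝕜) • H (Matrix.vecMulVec a b) (Matrix.vecMulVec c d) := fun a b c d => by
    rw [hs, hsym, hs]
  have hc := dotProduct_mulVec_comm hC
  simp only [minorContraction, symProd_mul_mul_symProd, trace_mul_symProd hC, map_add, map_smul,
    LinearMap.add_apply, LinearMap.smul_apply, hsym, hsym']
  simp only [hc w₀ u₀, hc w₀ u₁, hc w₀ u₂, hc u₁ u₀, hc u₂ u₀, hc u₂ u₁, hv w₀ u₀, hv w₀ u₁,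
    hv w₀ u₂, hv u₁ u₀, hv u₂ u₀, hv u₂ u₁]
  module

/-- Of the eight chains in XCYCZ, those that pair two u's, or leave two u's as arguments of `H`, are
symmetric and cancel. The two remaining chains become the products of traces after a cyclic
permutation of the three u's. A 3-cycle is even, hence the minus sign here, in contrast to the plus
sign where a transposition is used. -/
theorem minorContraction_linear_three {C : Matrix m m 𝕜} (hC : C.IsSymm)
    (H : Matrix m m 𝕜 →ₗ[𝕜] E) (hH : ∀ X, H Xᵀ = H X) (u₀ u₁ u₂ w₀ w₁ w₂ : m → 𝕜) :
    minorContraction (fun X Y Z => (8 : 𝕜) • H (X * C * Y * C * Z) -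
      (((C * X).trace * (C * Y).trace) • H Z + ((C * Y).trace * (C * Z).trace) • H X))
      u₀ u₁ u₂ w₀ w₁ w₂ = 0 := by
  have hv : ∀ a b, H (Matrix.vecMulVec a b) = H (Matrix.vecMulVec b a) := fun a b => by
    rw [← hH, Matrix.transpose_vecMulVec]
  have hsym : ∀ a b, H (symProd a b) = (2 : 𝕜) • H (Matrix.vecMulVec a b) := fun a b => by
    rw [symProd, map_add, hv b a, two_smul]
  have hp : ∀ a b u w : m → 𝕜, Matrix.vecMulVec a b * C * symProd u w =
      (b ⬝ᵥ C *ᵥ u) • Matrix.vecMulVec a w + (b ⬝ᵥ C *ᵥ w) • Matrix.vecMulVec a u := by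
    intro a b u w
    simp only [symProd, mul_add, vecMulVec_mul_mul_vecMulVec]
  have hc := dotProduct_mulVec_comm hC
  simp only [minorContraction, symProd_mul_mul_symProd, trace_mul_symProd hC, map_add, map_smul,
    hsym, hp, add_mul, Matrix.smul_mul]
  simp only [hc w₀ u₀, hc w₀ u₁, hc w₀ u₂, hc w₁ u₀, hc w₁ u₁, hc w₁ u₂,
    hc u₁ u₀, hc u₂ u₀, hc u₂ u₁, hv w₀ u₀, hv w₀ u₁, hv w₀ u₂, hv u₁ u₀, hv u₂ u₀, hv u₂ u₁]
  module

theorem minorContraction_linear_two {C : Matrix m m 𝕜} (hC : C.IsSymm)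
    (H : Matrix m m 𝕜 →ₗ[𝕜] E) (hH : ∀ X, H Xᵀ = H X) (u₀ u₁ u₂ w₀ w₁ w₂ : m → 𝕜) :
    minorContraction (fun X Y Z => (C * X).trace • ((4 : 𝕜) • H (Y * C * Z) +
      ((C * Y).trace • H Z + (C * Z).trace • H Y)))
      u₀ u₁ u₂ w₀ w₁ w₂ = 0 := by
  have hv : ∀ a b, H (Matrix.vecMulVec a b) = H (Matrix.vecMulVec b a) := fun a b => by
    rw [← hH, Matrix.transpose_vecMulVec]
  have hsym : ∀ a b, H (symProd a b) = (2 : 𝕜) • H (Matrix.vecMulVec a b) := fun a b => by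
    rw [symProd, map_add, hv b a, two_smul]
  have hc := dotProduct_mulVec_comm hC
  simp only [minorContraction, symProd_mul_mul_symProd, trace_mul_symProd hC, map_add, map_smul,
    hsym]
  simp only [hc w₁ u₀, hc w₁ u₁, hc w₁ u₂,
    hc u₁ u₀, hc u₂ u₀, hc u₂ u₁,
    hv w₁ u₀, hv w₁ u₁, hv w₁ u₂,
    hv u₁ u₀, hv u₂ u₀, hv u₂ u₁]
  module

/-- A transposition of the u's exchanges the surviving part of tr(CXCY) with the product of the
traces; the part containing a u–u pairing is symmetric and cancels. -/
theorem minorContraction_linear_one {C : Matrix m m 𝕜} (hC : C.IsSymm)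
    (H : Matrix m m 𝕜 →ₗ[𝕜] E) (u₀ u₁ u₂ w₀ w₁ w₂ : m → 𝕜) :
    minorContraction (fun X Y Z => (2 * (C * X * C * Y).trace + (C * X).trace * (C * Y).trace) •
      H Z) u₀ u₁ u₂ w₀ w₁ w₂ = 0 := by
  have hc := dotProduct_mulVec_comm hC
  simp only [minorContraction, trace_mul_symProd_two hC, trace_mul_symProd hC]
  simp only [
    hc u₁ u₀, hc u₂ u₀, hc u₂ u₁]
  module

theorem minorContraction_const_two {C : Matrix m m 𝕜} (hC : C.IsSymm) (e : E)
    (u₀ u₁ u₂ w₀ w₁ w₂ : m → 𝕜) :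
    minorContraction (fun X Y Z => ((C * X).trace *
      (2 * (C * Y * C * Z).trace + (C * Y).trace * (C * Z).trace)) • e) u₀ u₁ u₂ w₀ w₁ w₂ = 0 := by
  have hc := dotProduct_mulVec_comm hC
  simp only [minorContraction, trace_mul_symProd_two hC, trace_mul_symProd hC]
  simp only [
    hc u₁ u₀, hc u₂ u₀, hc u₂ u₁]
  module

/-- The closed chain behaves as the open one: the terms free of u–u pairings are related to the
product of three traces by an even 3-cycle. -/
theorem minorContraction_const_three {C : Matrix m m 𝕜} (hC : C.IsSymm) (e : E)
    (u₀ u₁ u₂ w₀ w₁ w₂ : m → 𝕜) :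
    minorContraction (fun X Y Z => (4 * (C * X * C * Y * C * Z).trace -
      (C * X).trace * (C * Y).trace * (C * Z).trace) • e) u₀ u₁ u₂ w₀ w₁ w₂ = 0 := by
  have hc := dotProduct_mulVec_comm hC
  have hp : ∀ a b u w : m → 𝕜, Matrix.vecMulVec a b * C * symProd u w =
      (b ⬝ᵥ C *ᵥ u) • Matrix.vecMulVec a w + (b ⬝ᵥ C *ᵥ w) • Matrix.vecMulVec a u := by
    intro a b u w
    simp only [symProd, mul_add, vecMulVec_mul_mul_vecMulVec]
  have ht : ∀ X Y Z, C * X * C * Y * C * Z = C * (X * C * Y * C * Z) := fun X Y Z => by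
    simp only [mul_assoc]
  simp only [minorContraction, trace_mul_symProd hC, ht, symProd_mul_mul_symProd, hp, add_mul,
    Matrix.smul_mul, mul_add, Matrix.mul_smul, Matrix.trace_add, Matrix.trace_smul,
    trace_mul_vecMulVec, smul_add, smul_eq_mul]
  simp only [hc w₀ u₀, hc w₀ u₁, hc w₀ u₂, hc w₁ u₀, hc w₁ u₁, hc w₁ u₂, hc w₂ u₀, hc w₂ u₁,
    hc w₂ u₂, hc u₁ u₀, hc u₂ u₀, hc u₂ u₁, hc w₂ w₀]
  module

end ContractionIdentities

/-! ### The third-order jet of a weighted fractional linear pullback -/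

section JetContraction

variable {𝕜 E m : Type*} [Field 𝕜] [AddCommGroup E] [Module 𝕜 E] [Fintype m]

/-- A trilinear function whose diagonal is the third order part of
`det(1 + CZ)⁻¹ H(Z(1 + CZ)⁻¹)` at `0`, for a jet `H₀, H₁, H₂, H₃`. -/
def jetTrilinear (C : Matrix m m 𝕜) (H₀ : E) (H₁ : Matrix m m 𝕜 →ₗ[𝕜] E)
    (H₂ : Matrix m m 𝕜 →ₗ[𝕜] Matrix m m 𝕜 →ₗ[𝕜] E)
    (H₃ : Matrix m m 𝕜 →ₗ[𝕜] Matrix m m 𝕜 →ₗ[𝕜] Matrix m m 𝕜 →ₗ[𝕜] E)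
    (X Y Z : Matrix m m 𝕜) : E :=
  H₃ X Y Z
  + (-3 / 2 : 𝕜) • ((4 : 𝕜) • H₂ (X * C * Y) Z +
      ((C * X).trace • H₂ Y Z + (C * Y).trace • H₂ X Z))
  + (3 / 4 : 𝕜) • ((8 : 𝕜) • H₁ (X * C * Y * C * Z) -
      (((C * X).trace * (C * Y).trace) • H₁ Z + ((C * Y).trace * (C * Z).trace) • H₁ X))
  + (3 / 2 : 𝕜) • ((C * X).trace • ((4 : 𝕜) • H₁ (Y * C * Z) +
      ((C * Y).trace • H₁ Z + (C * Z).trace • H₁ Y)))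
  + (3 / 2 : 𝕜) • ((2 * (C * X * C * Y).trace + (C * X).trace * (C * Y).trace) • H₁ Z)
  - (3 / 2 : 𝕜) • (((C * X).trace *
      (2 * (C * Y * C * Z).trace + (C * Y).trace * (C * Z).trace)) • H₀)
  - (1 / 2 : 𝕜) • ((4 * (C * X * C * Y * C * Z).trace -
      (C * X).trace * (C * Y).trace * (C * Z).trace) • H₀)

variable {C : Matrix m m 𝕜} {H₀ : E} {H₁ : Matrix m m 𝕜 →ₗ[𝕜] E}
  {H₂ : Matrix m m 𝕜 →ₗ[𝕜] Matrix m m 𝕜 →ₗ[𝕜] E}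
  {H₃ : Matrix m m 𝕜 →ₗ[𝕜] Matrix m m 𝕜 →ₗ[𝕜] Matrix m m 𝕜 →ₗ[𝕜] E}

theorem minorContraction_jetTrilinear (hC : C.IsSymm)
    (hH₁ : ∀ X, H₁ Xᵀ = H₁ X) (hH₂ : ∀ X Y, H₂ Xᵀ Y = H₂ X Y) (hs₂ : ∀ X Y, H₂ X Y = H₂ Y X)
    (u₀ u₁ u₂ w₀ w₁ w₂ : m → 𝕜)
    (hH₃ : minorContraction (fun X Y Z => H₃ X Y Z) u₀ u₁ u₂ w₀ w₁ w₂ = 0) :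
    minorContraction (jetTrilinear C H₀ H₁ H₂ H₃) u₀ u₁ u₂ w₀ w₁ w₂ = 0 := by
  have e2 := minorContraction_bilinear hC H₂ hH₂ hs₂ u₀ u₁ u₂ w₀ w₁ w₂
  have e13 := minorContraction_linear_three hC H₁ hH₁ u₀ u₁ u₂ w₀ w₁ w₂
  have e12 := minorContraction_linear_two hC H₁ hH₁ u₀ u₁ u₂ w₀ w₁ w₂
  have e11 := minorContraction_linear_one hC H₁ u₀ u₁ u₂ w₀ w₁ w₂
  have e02 := minorContraction_const_two hC H₀ u₀ u₁ u₂ w₀ w₁ w₂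
  have e03 := minorContraction_const_three hC H₀ u₀ u₁ u₂ w₀ w₁ w₂
  simp only [minorContraction] at hH₃ e2 e13 e12 e11 e02 e03
  simp only [minorContraction, jetTrilinear]
  -- Each group is made opaque, so that only a linear combination of the six vanishing contractions
  -- and that of `H₃` remains.
  generalize hf2 : (fun X Y Z => (4 : 𝕜) • H₂ (X * C * Y) Z +
      ((C * X).trace • H₂ Y Z + (C * Y).trace • H₂ X Z)) = f2 at *
  have r2 := fun X Y Z => congrFun (congrFun (congrFun hf2 X) Y) Z
  generalize hf13 : (fun X Y Z => (8 : 𝕜) • H₁ (X * C * Y * C * Z) -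
      (((C * X).trace * (C * Y).trace) • H₁ Z + ((C * Y).trace * (C * Z).trace) • H₁ X)) = f13 at *
  have r13 := fun X Y Z => congrFun (congrFun (congrFun hf13 X) Y) Z
  generalize hf12 : (fun X Y Z => (C * X).trace • ((4 : 𝕜) • H₁ (Y * C * Z) +
      ((C * Y).trace • H₁ Z + (C * Z).trace • H₁ Y))) = f12 at *
  have r12 := fun X Y Z => congrFun (congrFun (congrFun hf12 X) Y) Z
  generalize hf11 : (fun X Y Z => (2 * (C * X * C * Y).trace + (C * X).trace * (C * Y).trace) •
      H₁ Z) = f11 at *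
  have r11 := fun X Y Z => congrFun (congrFun (congrFun hf11 X) Y) Z
  generalize hf02 : (fun X Y Z => ((C * X).trace *
      (2 * (C * Y * C * Z).trace + (C * Y).trace * (C * Z).trace)) • H₀) = f02 at *
  have r02 := fun X Y Z => congrFun (congrFun (congrFun hf02 X) Y) Z
  generalize hf03 : (fun X Y Z => (4 * (C * X * C * Y * C * Z).trace -
      (C * X).trace * (C * Y).trace * (C * Z).trace) • H₀) = f03 at *
  have r03 := fun X Y Z => congrFun (congrFun (congrFun hf03 X) Y) Z
  simp only [r2, r13, r12, r11, r02, r03] at *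
  linear_combination (norm := module) hH₃ + (-3 / 2 : 𝕜) • e2 + (3 / 4 : 𝕜) • e13 +
    (3 / 2 : 𝕜) • e12 + (3 / 2 : 𝕜) • e11 - (3 / 2 : 𝕜) • e02 - (1 / 2 : 𝕜) • e03

/-- If the diagonal of a trilinear form `T` on symmetric matrices is the third order part of
`det(1 + CZ)⁻¹ H(Z(1 + CZ)⁻¹)`, and the third order part of `H` is annihilated by the minors, then
so is `T`. -/
theorem minorContraction_eq_zero_of_diagonal [CharZero 𝕜] (hC : C.IsSymm)
    (hH₁ : ∀ X, H₁ Xᵀ = H₁ X) (hH₂ : ∀ X Y, H₂ Xᵀ Y = H₂ X Y) (hs₂ : ∀ X Y, H₂ X Y = H₂ Y X)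
    (hH₃ : ∀ u₀ u₁ u₂ w₀ w₁ w₂,
      minorContraction (fun X Y Z => H₃ X Y Z) u₀ u₁ u₂ w₀ w₁ w₂ = 0)
    (T : Matrix m m 𝕜 →ₗ[𝕜] Matrix m m 𝕜 →ₗ[𝕜] Matrix m m 𝕜 →ₗ[𝕜] E)
    (hT₁ : ∀ X Y Z, T X Y Z = T Y X Z) (hT₂ : ∀ X Y Z, T X Y Z = T X Z Y)
    (hdiag : ∀ Z : Matrix m m 𝕜, Z.IsSymm → T Z Z Z =
      H₃ Z Z Z - (6 : 𝕜) • H₂ (Z * C * Z) Z + (6 : 𝕜) • H₁ (Z * C * Z * C * Z)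
      - (3 * (C * Z).trace) • (H₂ Z Z - (2 : 𝕜) • H₁ (Z * C * Z))
      + (3 * ((C * Z).trace ^ 2 + (C * Z * C * Z).trace)) • H₁ Z
      - ((C * Z).trace ^ 3 + 3 * (C * Z).trace * (C * Z * C * Z).trace
        + 2 * (C * Z * C * Z * C * Z).trace) • H₀)
    (u₀ u₁ u₂ w₀ w₁ w₂ : m → 𝕜) :
    minorContraction (fun X Y Z => T X Y Z) u₀ u₁ u₂ w₀ w₁ w₂ = 0 := by
  let P : AddSubgroup (Matrix m m 𝕜) :=
    { carrier := {Z | Z.IsSymm}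
      add_mem' := fun h h' => h.add h'
      zero_mem' := Matrix.isSymm_zero
      neg_mem' := fun h => h.neg }
  have hP : ∀ u w : m → 𝕜, symProd u w ∈ P := fun u w => symProd_transpose u w
  have key : ∀ X ∈ P, ∀ Y ∈ P, ∀ Z ∈ P, (6 : 𝕜) • T X Y Z =
      jetTrilinear C H₀ H₁ H₂ H₃ X Y Z + jetTrilinear C H₀ H₁ H₂ H₃ Y Z X +
      jetTrilinear C H₀ H₁ H₂ H₃ Z X Y + jetTrilinear C H₀ H₁ H₂ H₃ Y X Z +
      jetTrilinear C H₀ H₁ H₂ H₃ X Z Y + jetTrilinear C H₀ H₁ H₂ H₃ Z Y X := by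
    intro X hX Y hY Z hZ
    -- Only diagonal values on symmetric matrices are known. Polarizing the difference of the two
    -- forms compares the symmetric form `T` with the symmetrization of the non-symmetric
    -- `jetTrilinear`.
    have h := sum_perm_eq_zero_of_diagonal P
      (fun X Y Z => T X Y Z - jetTrilinear C H₀ H₁ H₂ H₃ X Y Z) ?_ ?_ ?_ ?_ hX hY hZ
    · rw [hT₂ Y Z X, hT₁ Y X Z, hT₁ Z X Y, hT₂ X Z Y, hT₁ Z Y X, hT₂ Y Z X, hT₁ Y X Z] at h
      linear_combination (norm := module) h
    · intro X Y Z W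
      simp only [jetTrilinear, map_add, LinearMap.add_apply, add_mul, mul_add, Matrix.trace_add]
      module
    · intro X Y Z W
      simp only [jetTrilinear, map_add, LinearMap.add_apply, add_mul, mul_add, Matrix.trace_add]
      module
    · intro X Y Z W
      simp only [jetTrilinear, map_add, mul_add, Matrix.trace_add]
      module
    · intro X hX
      rw [hdiag X hX, jetTrilinear]
      module
  -- Permuting the slots of `jetTrilinear` moves the u's and the w's together. After
  -- antisymmetrization in the u's this is, up to sign, a permutation of the w's alone, so the
  -- contraction is needed for all six orders of the w's.
  have h0 := fun v₀ v₁ v₂ => minorContraction_jetTrilinear (H₀ := H₀) hC hH₁ hH₂ hs₂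
    u₀ u₁ u₂ v₀ v₁ v₂ (hH₃ u₀ u₁ u₂ v₀ v₁ v₂)
  have a1 := h0 w₀ w₁ w₂
  have a2 := h0 w₁ w₂ w₀
  have a3 := h0 w₂ w₀ w₁
  have a4 := h0 w₁ w₀ w₂
  have a5 := h0 w₀ w₂ w₁
  have a6 := h0 w₂ w₁ w₀
  have k := fun v₀ v₁ v₂ => key _ (hP v₀ w₀) _ (hP v₁ w₁) _ (hP v₂ w₂)
  have k1 := k u₀ u₁ u₂
  have k2 := k u₁ u₂ u₀
  have k3 := k u₂ u₀ u₁
  have k4 := k u₁ u₀ u₂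
  have k5 := k u₀ u₂ u₁
  have k6 := k u₂ u₁ u₀
  clear key h0 hH₃ hdiag hT₁ hT₂ k
  simp only [minorContraction] at a1 a2 a3 a4 a5 a6 ⊢
  have h6 : (6 : 𝕜) ≠ 0 := by norm_num
  refine (smul_eq_zero.1 (?_ : (6 : 𝕜) • _ = (0 : E))).resolve_left h6
  generalize jetTrilinear C H₀ H₁ H₂ H₃ = J at *
  linear_combination (norm := module) k1 + k2 + k3 - k4 - k5 - k6 + a1 + a2 + a3 - a4 - a5 - a6

end JetContraction

/-! ### Third derivatives and their values along curves -/

section ThirdDerivative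

open Filter Topology

variable {𝕜 V E : Type*} [RCLike 𝕜] [NormedAddCommGroup V] [NormedSpace 𝕜 V]
  [NormedAddCommGroup E] [NormedSpace 𝕜 E]

theorem fderiv_fderiv_comm {G : V → E} {x : V} (hG : ContDiffAt 𝕜 2 G x) (v w : V) :
    fderiv 𝕜 (fderiv 𝕜 G) x v w = fderiv 𝕜 (fderiv 𝕜 G) x w v :=
  (hG.isSymmSndFDerivAt (by simp)).eq v w

theorem ContDiffAt.fderiv_of_succ {G : V → E} {x : V} {k : ℕ} (hG : ContDiffAt 𝕜 (k + 1 : ℕ) G x) :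
    ContDiffAt 𝕜 k (fderiv 𝕜 G) x :=
  hG.fderiv_right (m := k) (by norm_cast)

theorem fderiv_three_comm_left {G : V → E} {x : V} (hG : ContDiffAt 𝕜 3 G x) (u v w : V) :
    fderiv 𝕜 (fderiv 𝕜 (fderiv 𝕜 G)) x u v w = fderiv 𝕜 (fderiv 𝕜 (fderiv 𝕜 G)) x v u w := by
  rw [fderiv_fderiv_comm (ContDiffAt.fderiv_of_succ (k := 2) hG)]

theorem ContDiffAt.differentiableAt_fderiv {G : V → E} {x : V} (hG : ContDiffAt 𝕜 2 G x) :
    DifferentiableAt 𝕜 (fderiv 𝕜 G) x :=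
  (ContDiffAt.fderiv_of_succ (k := 1) hG).differentiableAt (by norm_num)

theorem ContDiffAt.differentiableAt_fderiv_two {G : V → E} {x : V} (hG : ContDiffAt 𝕜 3 G x) :
    DifferentiableAt 𝕜 (fderiv 𝕜 (fderiv 𝕜 G)) x :=
  ContDiffAt.differentiableAt_fderiv (ContDiffAt.fderiv_of_succ (k := 2) hG)

/-- The second derivative is symmetric at all nearby points, and this identity of functions is
differentiated once more. -/
theorem fderiv_three_comm_right {G : V → E} {x : V} (hG : ContDiffAt 𝕜 3 G x) (u v w : V) :
    fderiv 𝕜 (fderiv 𝕜 (fderiv 𝕜 G)) x u v w = fderiv 𝕜 (fderiv 𝕜 (fderiv 𝕜 G)) x u w v := by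
  have hd := hG.differentiableAt_fderiv_two
  have hev : ∀ᶠ y in 𝓝 x, fderiv 𝕜 (fderiv 𝕜 G) y v w = fderiv 𝕜 (fderiv 𝕜 G) y w v :=
    (hG.eventually (by simp)).mono fun y hy =>
      fderiv_fderiv_comm (hy.of_le (by norm_cast)) v w
  have h1 : ∀ a b : V, HasFDerivAt (fun y => fderiv 𝕜 (fderiv 𝕜 G) y a b)
      (((fderiv 𝕜 (fderiv 𝕜 (fderiv 𝕜 G)) x).flip a).flip b) x := by
    intro a b
    have := (hd.hasFDerivAt.clm_apply (hasFDerivAt_const a x)).clm_apply (hasFDerivAt_const b x)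
    refine this.congr_fderiv ?_
    ext c
    simp
  have := (h1 v w).unique ((h1 w v).congr_of_eventuallyEq hev)
  simpa using congrArg (fun L => L u) this

theorem DifferentiableAt.hasDerivAt_comp {G : V → E} {γ : 𝕜 → V} {v : V} {t : 𝕜}
    (hG : DifferentiableAt 𝕜 G (γ t)) (hγ : HasDerivAt γ v t) :
    HasDerivAt (fun s => G (γ s)) (fderiv 𝕜 G (γ t) v) t :=
  hG.hasFDerivAt.comp_hasDerivAt t hγ

/-- The Leibniz and chain rules to third order. The derivatives of the data are supplied as explicit
functions; the first two are required near 0 because they are differentiated again, the third only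
at 0. -/
theorem deriv_three_smul_comp {G : V → E} {δ δ₁ δ₂ : 𝕜 → 𝕜} {δ₃ : 𝕜} {γ γ₁ γ₂ : 𝕜 → V} {γ₃ : V}
    (hδ : ∀ᶠ t in 𝓝 0, HasDerivAt δ (δ₁ t) t) (hδ₁ : ∀ᶠ t in 𝓝 0, HasDerivAt δ₁ (δ₂ t) t)
    (hδ₂ : HasDerivAt δ₂ δ₃ 0)
    (hγ : ∀ᶠ t in 𝓝 0, HasDerivAt γ (γ₁ t) t) (hγ₁ : ∀ᶠ t in 𝓝 0, HasDerivAt γ₁ (γ₂ t) t)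
    (hγ₂ : HasDerivAt γ₂ γ₃ 0) (hG : ContDiffAt 𝕜 3 G (γ 0)) :
    deriv (deriv (deriv fun t => δ t • G (γ t))) 0 =
      δ 0 • (fderiv 𝕜 (fderiv 𝕜 (fderiv 𝕜 G)) (γ 0) (γ₁ 0) (γ₁ 0) (γ₁ 0)
        + (3 : 𝕜) • fderiv 𝕜 (fderiv 𝕜 G) (γ 0) (γ₂ 0) (γ₁ 0) + fderiv 𝕜 G (γ 0) γ₃)
      + (3 * δ₁ 0) • (fderiv 𝕜 (fderiv 𝕜 G) (γ 0) (γ₁ 0) (γ₁ 0) + fderiv 𝕜 G (γ 0) (γ₂ 0))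
      + (3 * δ₂ 0) • fderiv 𝕜 G (γ 0) (γ₁ 0) + δ₃ • G (γ 0) := by
  have hcont : ContinuousAt γ 0 := hγ.self_of_nhds.continuousAt
  have hGn : ∀ᶠ t in 𝓝 0, ContDiffAt 𝕜 3 G (γ t) :=
    hcont.eventually (hG.eventually (by simp))
  have hh : ∀ᶠ t in 𝓝 0, HasDerivAt (fun t => G (γ t)) (fderiv 𝕜 G (γ t) (γ₁ t)) t := by
    filter_upwards [hGn, hγ] with t h1 h2
    exact (h1.differentiableAt (by norm_num)).hasDerivAt_comp h2
  have hh₁ : ∀ᶠ t in 𝓝 0, HasDerivAt (fun t => fderiv 𝕜 G (γ t) (γ₁ t))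
      (fderiv 𝕜 (fderiv 𝕜 G) (γ t) (γ₁ t) (γ₁ t) + fderiv 𝕜 G (γ t) (γ₂ t)) t := by
    filter_upwards [hGn, hγ, hγ₁] with t h1 h2 h3
    exact ((h1.of_le (by norm_cast)).differentiableAt_fderiv.hasDerivAt_comp h2).clm_apply h3
  have hh₂ : HasDerivAt
      (fun t => fderiv 𝕜 (fderiv 𝕜 G) (γ t) (γ₁ t) (γ₁ t) + fderiv 𝕜 G (γ t) (γ₂ t))
      (fderiv 𝕜 (fderiv 𝕜 (fderiv 𝕜 G)) (γ 0) (γ₁ 0) (γ₁ 0) (γ₁ 0)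
        + (3 : 𝕜) • fderiv 𝕜 (fderiv 𝕜 G) (γ 0) (γ₂ 0) (γ₁ 0) + fderiv 𝕜 G (γ 0) γ₃) 0 := by
    have h1 := hγ.self_of_nhds
    have h2 := hγ₁.self_of_nhds
    have k2 : HasDerivAt (fun t => fderiv 𝕜 (fderiv 𝕜 G) (γ t))
        (fderiv 𝕜 (fderiv 𝕜 (fderiv 𝕜 G)) (γ 0) (γ₁ 0)) 0 :=
      DifferentiableAt.hasDerivAt_comp (G := fderiv 𝕜 (fderiv 𝕜 G))
        hG.differentiableAt_fderiv_two h1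
    have hG2 : ContDiffAt 𝕜 2 G (γ 0) := hG.of_le (by norm_cast)
    have k1 : HasDerivAt (fun t => fderiv 𝕜 G (γ t)) (fderiv 𝕜 (fderiv 𝕜 G) (γ 0) (γ₁ 0)) 0 :=
      hG2.differentiableAt_fderiv.hasDerivAt_comp h1
    have h3 := ((k2.clm_apply h2).clm_apply h2).add (k1.clm_apply hγ₂)
    refine h3.congr_deriv ?_
    rw [add_apply, fderiv_fderiv_comm hG2 (γ₁ 0) (γ₂ 0)]
    module
  have hf : ∀ᶠ t in 𝓝 0, HasDerivAt (fun t => δ t • G (γ t))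
      (δ t • fderiv 𝕜 G (γ t) (γ₁ t) + δ₁ t • G (γ t)) t := by
    filter_upwards [hδ, hh] with t h1 h2 using h1.smul h2
  have hf₁ : ∀ᶠ t in 𝓝 0, HasDerivAt (fun t => δ t • fderiv 𝕜 G (γ t) (γ₁ t) + δ₁ t • G (γ t))
      (δ t • (fderiv 𝕜 (fderiv 𝕜 G) (γ t) (γ₁ t) (γ₁ t) + fderiv 𝕜 G (γ t) (γ₂ t))
        + δ₁ t • fderiv 𝕜 G (γ t) (γ₁ t)
        + (δ₁ t • fderiv 𝕜 G (γ t) (γ₁ t) + δ₂ t • G (γ t))) t := by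
    filter_upwards [hδ, hδ₁, hh, hh₁] with t h1 h2 h3 h4 using (h1.smul h4).add (h2.smul h3)
  have e1 : deriv (fun t => δ t • G (γ t)) =ᶠ[𝓝 0] _ := hf.mono fun t h => h.deriv
  have e2 : deriv (deriv (fun t => δ t • G (γ t))) =ᶠ[𝓝 0] _ :=
    e1.deriv.trans (hf₁.mono fun t h => h.deriv)
  rw [e2.deriv_eq]
  have g1 := hδ.self_of_nhds
  have g2 := hδ₁.self_of_nhds
  have g3 := hh.self_of_nhds
  have g4 := hh₁.self_of_nhds
  refine HasDerivAt.deriv ((((g1.smul hh₂).add (g2.smul g4)).add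
    ((g2.smul g4).add (hδ₂.smul g3))).congr_deriv ?_)
  module

theorem fderiv_three_diagonal {F : V → E} {x : V} (hF : ContDiffAt 𝕜 3 F x) (v : V) :
    fderiv 𝕜 (fderiv 𝕜 (fderiv 𝕜 F)) x v v v =
      deriv (deriv (deriv fun t : 𝕜 => F (x + t • v))) 0 := by
  have h := deriv_three_smul_comp (𝕜 := 𝕜) (G := F) (δ := fun _ => 1) (δ₁ := fun _ => 0)
    (δ₂ := fun _ => 0) (δ₃ := 0) (γ := fun t => x + t • v) (γ₁ := fun _ => v) (γ₂ := fun _ => 0)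
    (γ₃ := 0) (.of_forall fun t => hasDerivAt_const _ _) (.of_forall fun t => hasDerivAt_const _ _)
    (hasDerivAt_const _ _)
    (.of_forall fun t => by simpa using ((hasDerivAt_id t).smul_const v).const_add x)
    (.of_forall fun t => hasDerivAt_const _ _) (hasDerivAt_const _ _) (by simpa using hF)
  simpa using h.symm

end ThirdDerivative

/-! ### Calculus of matrix-valued functions -/

section MatrixCurve

variable {𝕜 m : Type*} [RCLike 𝕜] [Fintype m]

theorem HasDerivAt.matrix_mul_apply {A B : 𝕜 → Matrix m m 𝕜} {A' B' : Matrix m m 𝕜} {t : 𝕜}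
    (hA : HasDerivAt A A' t) (hB : HasDerivAt B B' t) :
    HasDerivAt (fun s => A s * B s) (A' * B t + A t * B') t := by
  refine hasDerivAt_pi.2 fun i => hasDerivAt_pi.2 fun j => ?_
  have h : ∀ k, HasDerivAt (fun s => A s i k * B s k j) (A' i k * B t k j + A t i k * B' k j) t :=
    fun k => (hasDerivAt_pi.1 (hasDerivAt_pi.1 hA i) k).mul
      (hasDerivAt_pi.1 (hasDerivAt_pi.1 hB k) j)
  simpa [Matrix.mul_apply, Finset.sum_add_distrib] using HasDerivAt.fun_sum fun k _ => h k

theorem HasDerivAt.matrix_trace {A : 𝕜 → Matrix m m 𝕜} {A' : Matrix m m 𝕜} {t : 𝕜}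
    (hA : HasDerivAt A A' t) : HasDerivAt (fun s => (A s).trace) A'.trace t :=
  HasDerivAt.fun_sum fun i _ => hasDerivAt_pi.1 (hasDerivAt_pi.1 hA i) i

end MatrixCurve

section MatrixSmooth

variable {𝕜 m W : Type*} [RCLike 𝕜] [Fintype m] [NormedAddCommGroup W] [NormedSpace 𝕜 W] {k : ℕ∞ω}

theorem contDiffAt_matrix {l : Type*} [Fintype l] {A : W → Matrix m l 𝕜} {x : W} :
    ContDiffAt 𝕜 k A x ↔ ∀ i j, ContDiffAt 𝕜 k (fun y => A y i j) x :=
  contDiffAt_pi.trans (forall_congr' fun _ => contDiffAt_pi)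

theorem ContDiffAt.matrix_mul {A B : W → Matrix m m 𝕜} {x : W} (hA : ContDiffAt 𝕜 k A x)
    (hB : ContDiffAt 𝕜 k B x) : ContDiffAt 𝕜 k (fun y => A y * B y) x := by
  refine contDiffAt_matrix.2 fun i j => ?_
  simp only [Matrix.mul_apply]
  exact ContDiffAt.sum fun l _ => (contDiffAt_matrix.1 hA i l).mul (contDiffAt_matrix.1 hB l j)

theorem ContDiffAt.matrix_mulVec {A : W → Matrix m m 𝕜} {v : W → m → 𝕜} {x : W}
    (hA : ContDiffAt 𝕜 k A x) (hv : ContDiffAt 𝕜 k v x) :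
    ContDiffAt 𝕜 k (fun y => A y *ᵥ v y) x := by
  refine contDiffAt_pi.2 fun i => ?_
  simp only [Matrix.mulVec, dotProduct]
  exact ContDiffAt.sum fun l _ => (contDiffAt_matrix.1 hA i l).mul (contDiffAt_pi.1 hv l)

variable [DecidableEq m]

theorem ContDiffAt.matrix_det {A : W → Matrix m m 𝕜} {x : W} (hA : ContDiffAt 𝕜 k A x) :
    ContDiffAt 𝕜 k (fun y => (A y).det) x := by
  simp only [Matrix.det_apply']
  exact ContDiffAt.sum fun σ _ => contDiffAt_const.mul
    (contDiffAt_prod fun i _ => contDiffAt_matrix.1 hA _ _)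

theorem ContDiffAt.matrix_inv {A : W → Matrix m m 𝕜} {x : W} (hA : ContDiffAt 𝕜 k A x)
    (hx : (A x).det ≠ 0) : ContDiffAt 𝕜 k (fun y => (A y)⁻¹) x := by
  simp only [Matrix.inv_def, Ring.inverse_eq_inv']
  refine (hA.matrix_det.inv hx).smul (contDiffAt_matrix.2 fun i j => ?_)
  simp only [Matrix.adjugate_apply]
  refine ContDiffAt.matrix_det (contDiffAt_matrix.2 fun a b => ?_)
  simp only [Matrix.updateRow_apply]
  split_ifs
  · exact contDiffAt_const
  · exact contDiffAt_matrix.1 hA a b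

end MatrixSmooth

section InverseCurve

open Filter Topology

variable {𝕜 m : Type*} [RCLike 𝕜] [Fintype m] [DecidableEq m]

theorem hasDerivAt_one_add_smul (M : Matrix m m 𝕜) (t : 𝕜) :
    HasDerivAt (fun s : 𝕜 => 1 + s • M) M t :=
  (((hasDerivAt_id t).smul_const M).const_add 1).congr_deriv (one_smul _ _)

theorem hasDerivAt_inv_one_add_smul (M : Matrix m m 𝕜) {t : 𝕜} (ht : (1 + t • M).det ≠ 0) :
    HasDerivAt (fun s : 𝕜 => (1 + s • M)⁻¹) (-((1 + t • M)⁻¹ * M * (1 + t • M)⁻¹)) t := by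
  have hA := hasDerivAt_one_add_smul M t
  have hc : ContDiffAt 𝕜 1 (fun s : 𝕜 => 1 + s • M) t := by fun_prop
  have hB := ((hc.matrix_inv ht).differentiableAt (by norm_num)).hasDerivAt
  have h1 := hA.matrix_mul_apply hB
  have hev : (fun s : 𝕜 => (1 + s • M) * (1 + s • M)⁻¹) =ᶠ[𝓝 t] fun _ => 1 :=
    (hc.matrix_det.continuousAt.eventually_ne ht).mono fun s hs =>
      Matrix.mul_nonsing_inv _ (isUnit_iff_ne_zero.2 hs)
  have h2 := h1.unique ((hasDerivAt_const t (1 : Matrix m m 𝕜)).congr_of_eventuallyEq hev)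
  refine hB.congr_deriv ?_
  have h3 := congrArg (fun X => (1 + t • M)⁻¹ * X) (eq_neg_of_add_eq_zero_right h2)
  rw [Matrix.nonsing_inv_mul_cancel_left _ _ (isUnit_iff_ne_zero.2 ht)] at h3
  rw [h3, mul_neg, mul_assoc]

/-- Factoring out the matrix at `t` reduces the claim to the expansion of det(1 + hN) as 1 + h tr N
plus h² times a polynomial in h. -/
theorem hasDerivAt_det_one_add_smul (M : Matrix m m 𝕜) {t : 𝕜} (ht : (1 + t • M).det ≠ 0) :
    HasDerivAt (fun s : 𝕜 => (1 + s • M).det)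
      ((1 + t • M).det * (M * (1 + t • M)⁻¹).trace) t := by
  have hu := isUnit_iff_ne_zero.2 ht
  have e : ∀ s : 𝕜, (1 + s • M).det =
      (1 + t • M).det * (1 + (s - t) • (M * (1 + t • M)⁻¹)).det := by
    intro s
    rw [mul_comm, ← Matrix.det_mul]
    congr 1
    rw [add_mul, one_mul, smul_mul_assoc, Matrix.nonsing_inv_mul_cancel_right _ _ hu, sub_smul]
    abel
  have h1 : HasDerivAt (fun s : 𝕜 => s - t) 1 t := (hasDerivAt_id t).sub_const t
  set q := (1 + (Polynomial.X : Polynomial 𝕜) • (M * (1 + t • M)⁻¹).map Polynomial.C).det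
    |>.divX.divX
  have h2 := HasDerivAt.comp (h := fun s => s - t) t (q.hasDerivAt (t - t)) h1
  have h3 := ((h1.const_mul (M * (1 + t • M)⁻¹).trace).const_add 1).add (h2.mul (h1.pow 2))
  refine ((h3.const_mul (1 + t • M).det).congr_deriv (by simp)).congr_of_eventuallyEq
    (.of_forall fun s => ?_)
  change (1 + s • M).det = (1 + t • M).det *
    (1 + (M * (1 + t • M)⁻¹).trace * (s - t) + q.eval (s - t) * (s - t) ^ 2)
  rw [e s, Matrix.det_one_add_smul (s - t)]

theorem eventually_det_one_add_smul_ne_zero (M : Matrix m m 𝕜) :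
    ∀ᶠ t : 𝕜 in 𝓝 0, (1 + t • M).det ≠ 0 := by
  have hc : ContDiffAt 𝕜 1 (fun s : 𝕜 => 1 + s • M) 0 := by fun_prop
  exact hc.matrix_det.continuousAt.eventually_ne (by simp)

end InverseCurve

/-! ### Diagonal of the third derivative of a fractional linear pullback -/

section JetFormula

open Filter Topology

variable {𝕜 m V E : Type*} [RCLike 𝕜] [Fintype m] [DecidableEq m] [NormedAddCommGroup V]
  [NormedSpace 𝕜 V] [NormedAddCommGroup E] [NormedSpace 𝕜 E]

/-- The curve t ↦ tZ(1 + tCZ)⁻¹ has derivatives Z, -2ZCZ, 6ZCZCZ at 0, and those of det(1 + tCZ)⁻¹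
are polynomials in traces of powers of CZ. Inserting them in the third-order chain rule gives the
formula. -/
theorem fderiv_three_diagonal_of_eventuallyEq {F G : V → E} {x y w : V} (hF : ContDiffAt 𝕜 3 F x)
    (hG : ContDiffAt 𝕜 3 G y) (L : Matrix m m 𝕜 →L[𝕜] V) (C Z : Matrix m m 𝕜) (κ : 𝕜)
    (h : ∀ᶠ t : 𝕜 in 𝓝 0, F (x + t • w) = (κ * (1 + t • (C * Z)).det⁻¹) •
      G (y + L (t • Z * (1 + t • (C * Z))⁻¹))) :
    fderiv 𝕜 (fderiv 𝕜 (fderiv 𝕜 F)) x w w w = κ • (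
      fderiv 𝕜 (fderiv 𝕜 (fderiv 𝕜 G)) y (L Z) (L Z) (L Z)
      - (6 : 𝕜) • fderiv 𝕜 (fderiv 𝕜 G) y (L (Z * C * Z)) (L Z)
      + (6 : 𝕜) • fderiv 𝕜 G y (L (Z * C * Z * C * Z))
      - (3 * (C * Z).trace) • (fderiv 𝕜 (fderiv 𝕜 G) y (L Z) (L Z)
        - (2 : 𝕜) • fderiv 𝕜 G y (L (Z * C * Z)))
      + (3 * ((C * Z).trace ^ 2 + (C * Z * C * Z).trace)) • fderiv 𝕜 G y (L Z)
      - ((C * Z).trace ^ 3 + 3 * (C * Z).trace * (C * Z * C * Z).trace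
        + 2 * (C * Z * C * Z * C * Z).trace) • G y) := by
  set M := C * Z with hM
  have hne := eventually_det_one_add_smul_ne_zero M
  set B : 𝕜 → Matrix m m 𝕜 := fun t => (1 + t • M)⁻¹ with hB
  have hBd : ∀ᶠ t in 𝓝 0, HasDerivAt B (-(B t * M * B t)) t :=
    hne.mono fun t ht => hasDerivAt_inv_one_add_smul M ht
  have hMc : ∀ t, HasDerivAt (fun _ : 𝕜 => M) 0 t := fun t => hasDerivAt_const t M
  have hZc : ∀ t, HasDerivAt (fun _ : 𝕜 => Z) 0 t := fun t => hasDerivAt_const t Z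
  have B0 : B 0 = 1 := by simp [hB]
  have hMB : ∀ᶠ t in 𝓝 0, HasDerivAt (fun t => M * B t) (-(M * B t * M * B t)) t :=
    hBd.mono fun t ht => ((hMc t).matrix_mul_apply ht).congr_deriv (by noncomm_ring)
  have hδ : ∀ᶠ t in 𝓝 0, HasDerivAt (fun t => κ * (1 + t • M).det⁻¹)
      (-(κ * (1 + t • M).det⁻¹ * (M * B t).trace)) t := by
    filter_upwards [hne] with t ht
    refine (((hasDerivAt_det_one_add_smul M ht).inv ht).const_mul κ).congr_deriv ?_
    simp only [hB]
    field_simp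
  have hδ₁ : ∀ᶠ t in 𝓝 0, HasDerivAt (fun t => -(κ * (1 + t • M).det⁻¹ * (M * B t).trace))
      (κ * (1 + t • M).det⁻¹ * ((M * B t).trace ^ 2 + (M * B t * M * B t).trace)) t := by
    filter_upwards [hδ, hMB] with t h1 h2
    refine ((h1.mul h2.matrix_trace).neg).congr_deriv ?_
    rw [Matrix.trace_neg]
    ring
  have hδ₂ : HasDerivAt
      (fun t => κ * (1 + t • M).det⁻¹ * ((M * B t).trace ^ 2 + (M * B t * M * B t).trace))
      (-κ * (M.trace ^ 3 + 3 * M.trace * (M * M).trace + 2 * (M * M * M).trace)) 0 := by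
    have h1 := hδ.self_of_nhds
    have h2 := hMB.self_of_nhds
    have h3 : HasDerivAt (fun t => M * B t * M * B t) _ 0 :=
      ((h2.matrix_mul_apply (hMc 0)).matrix_mul_apply hBd.self_of_nhds)
    refine (h1.mul ((h2.matrix_trace.pow 2).add h3.matrix_trace)).congr_deriv ?_
    simp only [B0, mul_one, one_mul, zero_smul, add_zero, Matrix.det_one, inv_one, neg_mul,
      mul_neg, mul_zero, Matrix.trace_neg, Matrix.trace_add, Pi.add_apply, Pi.pow_apply]
    norm_num
    ring
  have hY : ∀ᶠ t in 𝓝 0, HasDerivAt (fun t : 𝕜 => t • Z * B t) (Z * B t * B t) t := by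
    filter_upwards [hne, hBd] with t h0 h1
    have h2 : HasDerivAt (fun t : 𝕜 => t • Z) Z t :=
      ((hasDerivAt_id t).smul_const Z).congr_deriv (one_smul _ _)
    refine (h2.matrix_mul_apply h1).congr_deriv ?_
    -- The resolvent identity, which turns the derivative of tZB(t) into ZB(t)².
    have e : B t = 1 - t • (B t * M) := by
      have := Matrix.nonsing_inv_mul _ (isUnit_iff_ne_zero.2 h0)
      rw [mul_add, mul_one, mul_smul_comm] at this
      exact eq_sub_of_add_eq this
    calc Z * B t + t • Z * -(B t * M * B t) = Z * (1 - t • (B t * M)) * B t := by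
          simp only [mul_sub, sub_mul, mul_one, mul_neg, smul_mul_assoc, mul_smul_comm, mul_assoc,
            ← sub_eq_add_neg]
      _ = Z * B t * B t := by rw [← e]
  have hY₁ : ∀ᶠ t in 𝓝 0, HasDerivAt (fun t : 𝕜 => Z * B t * B t)
      (-(Z * B t * M * B t * B t) - Z * B t * B t * M * B t) t := by
    filter_upwards [hBd] with t h1
    exact (((hZc t).matrix_mul_apply h1).matrix_mul_apply h1).congr_deriv (by noncomm_ring)
  have hY₂ : HasDerivAt (fun t : 𝕜 => -(Z * B t * M * B t * B t) - Z * B t * B t * M * B t)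
      ((6 : 𝕜) • (Z * M * M)) 0 := by
    have h1 := hBd.self_of_nhds
    have h2 := (hZc 0).matrix_mul_apply h1
    have h3 := ((h2.matrix_mul_apply (hMc 0)).matrix_mul_apply h1).matrix_mul_apply h1
    have h4 := ((h2.matrix_mul_apply h1).matrix_mul_apply (hMc 0)).matrix_mul_apply h1
    refine (h3.neg.sub h4).congr_deriv ?_
    simp only [B0, mul_one, one_mul, mul_zero, zero_add, add_zero, mul_neg, neg_mul,
      add_mul]
    module
  have hL : ∀ {Y : 𝕜 → Matrix m m 𝕜} {Y' : Matrix m m 𝕜} {t : 𝕜}, HasDerivAt Y Y' t →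
      HasDerivAt (fun s => L (Y s)) (L Y') t := fun hY => L.hasFDerivAt.comp_hasDerivAt _ hY
  have hmain := deriv_three_smul_comp hδ hδ₁ hδ₂
    (γ := fun t => y + L (t • Z * B t)) (hY.mono fun t ht => (hL ht).const_add y)
    (hY₁.mono fun t ht => hL ht) (hL hY₂) (G := G) (by simpa using hG)
  have h' : (fun t : 𝕜 => F (x + t • w)) =ᶠ[𝓝 0]
      fun t => (κ * (1 + t • M).det⁻¹) • G (y + L (t • Z * B t)) := h
  rw [fderiv_three_diagonal hF, h'.deriv.deriv.deriv_eq, hmain]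
  have e1 : Z * M = Z * C * Z := by rw [hM, mul_assoc]
  have e2 : M * C * Z = M * M := by rw [hM]; simp only [mul_assoc]
  have e3 : Z * C * Z * M = Z * C * Z * C * Z := by rw [hM]; simp only [mul_assoc]
  have e4 : M * M * C * Z = M * M * M := by rw [hM]; simp only [mul_assoc]
  simp only [B0, mul_one, zero_smul, map_zero, add_zero, Matrix.det_one, inv_one, e1, e2,
    e3, e4, map_smul, map_sub, map_neg]
  simp only [sub_apply, neg_apply]
  module

end JetFormula

/-! ### Bordered symmetric matrices as a model of Symm × 𝕜ⁿ -/

section BlockProjection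

variable {n : ℕ} {𝕜 : Type*} [RCLike 𝕜]

/-- The projection of the square matrices of order `n + 1` to `Symm(n) × 𝕜ⁿ`: the first diagonal
block and the last column of the symmetric part. -/
def blockProj : Matrix (Fin n ⊕ Unit) (Fin n ⊕ Unit) 𝕜 →ₗ[𝕜] SymmAff n 𝕜 where
  toFun M := (⟨(1 / 2 : 𝕜) • (M.toBlocks₁₁ + M.toBlocks₁₁ᵀ), by
      change Matrix.IsSymm _
      simp [Matrix.IsSymm, add_comm]⟩,
    fun i => (1 / 2 : 𝕜) * (M (.inl i) (.inr ()) + M (.inr ()) (.inl i)))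
  map_add' M M' := by
    ext <;> simp [Matrix.toBlocks₁₁] <;> ring
  map_smul' a M := by
    ext <;> simp [Matrix.toBlocks₁₁] <;> ring

theorem blockProj_fst_apply (M : Matrix (Fin n ⊕ Unit) (Fin n ⊕ Unit) 𝕜) (i j : Fin n) :
    ((blockProj M).1 : Matrix (Fin n) (Fin n) 𝕜) i j =
      (1 / 2 : 𝕜) * (M (.inl i) (.inl j) + M (.inl j) (.inl i)) := rfl

theorem blockProj_snd_apply (M : Matrix (Fin n ⊕ Unit) (Fin n ⊕ Unit) 𝕜) (i : Fin n) :
    (blockProj M).2 i = (1 / 2 : 𝕜) * (M (.inl i) (.inr ()) + M (.inr ()) (.inl i)) := rfl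

theorem blockProj_transpose (M : Matrix (Fin n ⊕ Unit) (Fin n ⊕ Unit) 𝕜) :
    blockProj Mᵀ = blockProj M := by
  ext <;> simp only [blockProj_fst_apply, blockProj_snd_apply, Matrix.transpose_apply, add_comm]

theorem blockProj_of_isSymm {M : Matrix (Fin n ⊕ Unit) (Fin n ⊕ Unit) 𝕜} (hM : M.IsSymm) :
    ((blockProj M).1 : Matrix (Fin n) (Fin n) 𝕜) = M.toBlocks₁₁ ∧
      (blockProj M).2 = fun i => M (.inl i) (.inr ()) := by
  constructor
  · ext i j
    rw [blockProj_fst_apply, hM.apply (.inl i) (.inl j), Matrix.toBlocks₁₁, Matrix.of_apply]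
    ring
  · ext i
    rw [blockProj_snd_apply, hM.apply (.inl i) (.inr ())]
    ring

variable {E : Type*} [NormedAddCommGroup E] [NormedSpace 𝕜 E]

/-- The factor 2 on the diagonal is the one in e_k e_kᵀ + e_k e_kᵀ, and the zero in the corner
reflects that the projection forgets the corner. All entries of the operator matrix thereby get one
uniform description. -/
theorem detEntry_eq_fderiv (k l : Fin n ⊕ Unit) (G : SymmAff n 𝕜 → E) :
    detEntry 𝕜 k l G = fun x => fderiv 𝕜 G x
      (blockProj (symProd (Pi.single k 1) (Pi.single l 1))) := by
  funext x
  rcases k with k | k <;> rcases l with l | l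
  · have h : blockProj (symProd (Pi.single (.inl k) (1 : 𝕜)) (Pi.single (.inl l) 1)) =
        if k = l then (2 : 𝕜) • ((symmDir 𝕜 k k, 0) : SymmAff n 𝕜) else (symmDir 𝕜 k l, 0) := by
      split_ifs with hkl
      · subst hkl
        ext i j
        · simp only [blockProj_fst_apply, symProd, symmDir, Matrix.vecMulVec_apply,
            Matrix.add_apply, if_true, Prod.smul_fst, Submodule.coe_smul, Matrix.smul_apply,
            Matrix.single_apply, Pi.single_apply, Sum.inl.injEq, smul_eq_mul,
            eq_comm (a := k) (b := i), eq_comm (a := k) (b := j)]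
          by_cases h1 : i = k <;> by_cases h2 : j = k <;>
            simp [h1, h2]
          norm_num
        · simp [blockProj_snd_apply, symProd, Matrix.vecMulVec_apply]
      · ext i j
        · simp only [blockProj_fst_apply, symProd, symmDir, Matrix.vecMulVec_apply,
            Matrix.add_apply, if_neg hkl, Matrix.single_apply, Pi.single_apply, Sum.inl.injEq,
            eq_comm (a := k) (b := i), eq_comm (a := k) (b := j), eq_comm (a := l) (b := i),
            eq_comm (a := l) (b := j)]
          by_cases h1 : i = k <;> by_cases h2 : j = k <;> by_cases h3 : i = l <;>
            by_cases h4 : j = l <;> simp [h1, h2, h3, h4, hkl, Ne.symm hkl] <;> ring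
        · simp [blockProj_snd_apply, symProd, Matrix.vecMulVec_apply]
    rw [h]
    simp only [detEntry]
    split_ifs
    · rw [map_smul]; rfl
    · rfl
  · have h : blockProj (symProd (Pi.single (.inl k) (1 : 𝕜)) (Pi.single (.inr l) 1)) =
        (0, Pi.single k 1) := by
      ext i j
      · simp [blockProj_fst_apply, symProd, Matrix.vecMulVec_apply]
      · simp [blockProj_snd_apply, symProd, Matrix.vecMulVec_apply, Pi.single_apply]
        split_ifs <;> norm_num
    rw [h]; rfl
  · have h : blockProj (symProd (Pi.single (.inr k) (1 : 𝕜)) (Pi.single (.inl l) 1)) =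
        (0, Pi.single l 1) := by
      ext i j
      · simp [blockProj_fst_apply, symProd, Matrix.vecMulVec_apply]
      · simp [blockProj_snd_apply, symProd, Matrix.vecMulVec_apply, Pi.single_apply]
        split_ifs <;> norm_num
    rw [h]; rfl
  · have h : blockProj (symProd (Pi.single (.inr k) (1 : 𝕜)) (Pi.single (.inr l) 1)) =
        (0 : SymmAff n 𝕜) := by
      ext i j
      · simp [blockProj_fst_apply, symProd, Matrix.vecMulVec_apply]
      · simp [blockProj_snd_apply, symProd, Matrix.vecMulVec_apply]
    rw [h, map_zero]; rfl

end BlockProjection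

/-! ### Minors as contractions of the third derivative -/

section Minors

open Filter Topology

variable {𝕜 V E : Type*} [RCLike 𝕜] [NormedAddCommGroup V] [NormedSpace 𝕜 V]
  [NormedAddCommGroup E] [NormedSpace 𝕜 E]

theorem fderiv_fderiv_fderiv_apply {G : V → E} {x : V} (hG : ContDiffAt 𝕜 3 G x) (u v w : V) :
    fderiv 𝕜 (fun y => fderiv 𝕜 (fun z => fderiv 𝕜 G z w) y v) x u =
      fderiv 𝕜 (fderiv 𝕜 (fderiv 𝕜 G)) x u v w := by
  have h1 : (fun y => fderiv 𝕜 (fun z => fderiv 𝕜 G z w) y v) =ᶠ[𝓝 x]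
      fun y => fderiv 𝕜 (fderiv 𝕜 G) y v w := by
    filter_upwards [hG.eventually (by simp)] with y hy
    have hd := (hy.of_le (show (2 : ℕ∞ω) ≤ 3 by norm_cast)).differentiableAt_fderiv
    rw [(hd.hasFDerivAt.clm_apply (hasFDerivAt_const w y)).fderiv]
    simp
  rw [h1.fderiv_eq]
  have hd := hG.differentiableAt_fderiv_two
  rw [((hd.hasFDerivAt.clm_apply (hasFDerivAt_const v x)).clm_apply (hasFDerivAt_const w x)).fderiv]
  simp

/-- The third derivative, as a trilinear map, composed with a linear map in every argument. -/
noncomputable def thirdDerivComp {M : Type*} [AddCommGroup M] [Module 𝕜 M]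
    (G : V → E) (x : V) (L : M →ₗ[𝕜] V) : M →ₗ[𝕜] M →ₗ[𝕜] M →ₗ[𝕜] E where
  toFun X :=
    { toFun := fun Y => (fderiv 𝕜 (fderiv 𝕜 (fderiv 𝕜 G)) x (L X) (L Y)).toLinearMap ∘ₗ L
      map_add' := fun Y Y' => by ext; simp
      map_smul' := fun a Y => by ext; simp }
  map_add' X X' := by ext; simp
  map_smul' a X := by ext; simp

/-- The second derivative, as a bilinear map, composed with a linear map in both arguments. -/
noncomputable def secondDerivComp {M : Type*} [AddCommGroup M] [Module 𝕜 M]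
    (G : V → E) (x : V) (L : M →ₗ[𝕜] V) : M →ₗ[𝕜] M →ₗ[𝕜] E where
  toFun X := (fderiv 𝕜 (fderiv 𝕜 G) x (L X)).toLinearMap ∘ₗ L
  map_add' X X' := by ext; simp
  map_smul' a X := by ext; simp

theorem thirdDerivComp_apply {M : Type*} [AddCommGroup M] [Module 𝕜 M]
    (G : V → E) (x : V) (L : M →ₗ[𝕜] V) (X Y Z : M) :
    thirdDerivComp G x L X Y Z = fderiv 𝕜 (fderiv 𝕜 (fderiv 𝕜 G)) x (L X) (L Y) (L Z) := rfl

theorem secondDerivComp_apply {M : Type*} [AddCommGroup M] [Module 𝕜 M]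
    (G : V → E) (x : V) (L : M →ₗ[𝕜] V) (X Y : M) :
    secondDerivComp G x L X Y = fderiv 𝕜 (fderiv 𝕜 G) x (L X) (L Y) := rfl

/-- The analytic form of the jet argument. The two linear maps differ because the displacement at
the image point is also conjugated; `κ` absorbs the constant factor of the determinant. -/
theorem minorContraction_thirdDerivComp_eq_zero {m : Type*} [Fintype m] [DecidableEq m]
    {F G : V → E} {x y : V} (hF : ContDiffAt 𝕜 3 F x) (hG : ContDiffAt 𝕜 3 G y)
    (p L : Matrix m m 𝕜 →ₗ[𝕜] V) (hL : ∀ X, L Xᵀ = L X) {C : Matrix m m 𝕜} (hC : C.IsSymm) (κ : 𝕜)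
    (h : ∀ Z : Matrix m m 𝕜, Z.IsSymm → ∀ᶠ t : 𝕜 in 𝓝 0,
      F (x + t • p Z) = (κ * (1 + t • (C * Z)).det⁻¹) • G (y + L (t • Z * (1 + t • (C * Z))⁻¹)))
    (hG3 : ∀ u₀ u₁ u₂ w₀ w₁ w₂,
      minorContraction (fun X Y Z => thirdDerivComp G y L X Y Z) u₀ u₁ u₂ w₀ w₁ w₂ = 0)
    (u₀ u₁ u₂ w₀ w₁ w₂ : m → 𝕜) :
    minorContraction (fun X Y Z => thirdDerivComp F x p X Y Z) u₀ u₁ u₂ w₀ w₁ w₂ = 0 := by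
  refine minorContraction_eq_zero_of_diagonal (H₀ := κ • G y)
    (H₁ := κ • (fderiv 𝕜 G y).toLinearMap ∘ₗ L) (H₂ := κ • secondDerivComp G y L)
    (H₃ := κ • thirdDerivComp G y L) hC ?_ ?_ ?_ ?_ _ ?_ ?_ ?_ u₀ u₁ u₂ w₀ w₁ w₂
  · intro X
    simp [hL]
  · intro X Y
    simp [secondDerivComp_apply, hL]
  · intro X Y
    simp only [LinearMap.smul_apply, secondDerivComp_apply]
    rw [fderiv_fderiv_comm (hG.of_le (by norm_cast))]
  · intro u₀ u₁ u₂ w₀ w₁ w₂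
    have h0 := hG3 u₀ u₁ u₂ w₀ w₁ w₂
    simp only [minorContraction, LinearMap.smul_apply] at h0 ⊢
    linear_combination (norm := module) κ • h0
  · intro X Y Z
    rw [thirdDerivComp_apply, thirdDerivComp_apply, fderiv_three_comm_left hF]
  · intro X Y Z
    rw [thirdDerivComp_apply, thirdDerivComp_apply, fderiv_three_comm_right hF]
  · intro Z hZ
    rw [thirdDerivComp_apply, fderiv_three_diagonal_of_eventuallyEq hF hG
      (LinearMap.toContinuousLinearMap L) C Z κ (h Z hZ)]
    simp only [LinearMap.smul_apply, thirdDerivComp_apply, secondDerivComp_apply,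
      LinearMap.coe_toContinuousLinearMap', LinearMap.comp_apply, ContinuousLinearMap.coe_coe]
    module

variable {n : ℕ}

theorem detMinor_eq_minorContraction {G : SymmAff n 𝕜 → E} {x : SymmAff n 𝕜}
    (hG : ContDiffAt 𝕜 3 G x) (I J : Fin 3 ↪ Fin n ⊕ Unit) :
    detMinor 𝕜 I J G x =
      minorContraction (fun X Y Z => thirdDerivComp G x blockProj X Y Z)
        (Pi.single (I 0) 1) (Pi.single (I 1) 1) (Pi.single (I 2) 1)
        (Pi.single (J 0) 1) (Pi.single (J 1) 1) (Pi.single (J 2) 1) := by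
  have h : ∀ i j k : Fin 3,
      detEntry 𝕜 (I i) (J 0) (detEntry 𝕜 (I j) (J 1) (detEntry 𝕜 (I k) (J 2) G)) x =
      thirdDerivComp G x blockProj (symProd (Pi.single (I i) 1) (Pi.single (J 0) 1))
        (symProd (Pi.single (I j) 1) (Pi.single (J 1) 1))
        (symProd (Pi.single (I k) 1) (Pi.single (J 2) 1)) := by
    intro i j k
    simp only [detEntry_eq_fderiv]
    exact fderiv_fderiv_fderiv_apply hG _ _ _
  have e : detMinor 𝕜 I J G x = ∑ π : Equiv.Perm (Fin 3), Equiv.Perm.sign π •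
      detEntry 𝕜 (I (π 0)) (J 0) (detEntry 𝕜 (I (π 1)) (J 1) (detEntry 𝕜 (I (π 2)) (J 2) G)) x := by
    simp only [detMinor, Finset.sum_apply, Pi.smul_apply]
  rw [e]
  exact sum_perm_fin_three _ (fun i j k => thirdDerivComp G x blockProj
    (symProd (Pi.single (I i) 1) (Pi.single (J 0) 1))
    (symProd (Pi.single (I j) 1) (Pi.single (J 1) 1))
    (symProd (Pi.single (I k) 1) (Pi.single (J 2) 1))) fun π => h (π 0) (π 1) (π 2)

end Minors

/-! ### From coordinate minors to arbitrary vectors -/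

section Extension

variable {𝕜 E m : Type*} [Field 𝕜] [AddCommGroup E] [Module 𝕜 E] [Finite m] [DecidableEq m]

theorem pi_single_induction {p : (m → 𝕜) → Prop} (h : ∀ i, p (Pi.single i 1))
    (hadd : ∀ u v, p u → p v → p (u + v)) (hsmul : ∀ (a : 𝕜) u, p u → p (a • u)) (h0 : p 0)
    (u : m → 𝕜) : p u := by
  have hu : u ∈ Submodule.span 𝕜 (Set.range (Pi.basisFun 𝕜 m)) := by
    rw [(Pi.basisFun 𝕜 m).span_eq]; trivial
  induction hu using Submodule.span_induction with
  | mem x hx =>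
    obtain ⟨i, rfl⟩ := hx
    simpa using h i
  | zero => exact h0
  | add x y _ _ hx hy => exact hadd _ _ hx hy
  | smul a x _ hx => exact hsmul _ _ hx

/-- The contraction alternates in the u's by construction and in the w's because `T` is symmetric.
Repeated indices therefore contribute nothing, and multilinearity does the rest. Arbitrary vectors
are needed because a congruence does not preserve the coordinate vectors. -/
theorem minorContraction_eq_zero_of_single
    (T : Matrix m m 𝕜 →ₗ[𝕜] Matrix m m 𝕜 →ₗ[𝕜] Matrix m m 𝕜 →ₗ[𝕜] E)
    (hT₁ : ∀ X Y Z, T X Y Z = T Y X Z) (hT₂ : ∀ X Y Z, T X Y Z = T X Z Y)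
    (h : ∀ I J : Fin 3 ↪ m, minorContraction (fun X Y Z => T X Y Z)
      (Pi.single (I 0) 1) (Pi.single (I 1) 1) (Pi.single (I 2) 1)
      (Pi.single (J 0) 1) (Pi.single (J 1) 1) (Pi.single (J 2) 1) = 0)
    (u₀ u₁ u₂ w₀ w₁ w₂ : m → 𝕜) :
    minorContraction (fun X Y Z => T X Y Z) u₀ u₁ u₂ w₀ w₁ w₂ = 0 := by
  have alt_u : ∀ u v w₀ w₁ w₂ : m → 𝕜,
      minorContraction (fun X Y Z => T X Y Z) u u v w₀ w₁ w₂ = 0 ∧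
      minorContraction (fun X Y Z => T X Y Z) u v u w₀ w₁ w₂ = 0 ∧
      minorContraction (fun X Y Z => T X Y Z) v u u w₀ w₁ w₂ = 0 := by
    intro u v w₀ w₁ w₂
    simp only [minorContraction]
    refine ⟨?_, ?_, ?_⟩ <;> abel
  have alt_w : ∀ u₀ u₁ u₂ w v : m → 𝕜,
      minorContraction (fun X Y Z => T X Y Z) u₀ u₁ u₂ w w v = 0 ∧
      minorContraction (fun X Y Z => T X Y Z) u₀ u₁ u₂ w v w = 0 ∧
      minorContraction (fun X Y Z => T X Y Z) u₀ u₁ u₂ v w w = 0 := by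
    intro u₀ u₁ u₂ w v
    have hT₃ : ∀ X Y Z, T X Y Z = T Z Y X := fun X Y Z => by rw [hT₁, hT₂, hT₁]
    simp only [minorContraction]
    refine ⟨?_, ?_, ?_⟩
    · rw [hT₁ (symProd u₁ w) (symProd u₀ w), hT₁ (symProd u₂ w) (symProd u₀ w),
        hT₁ (symProd u₂ w) (symProd u₁ w)]
      abel
    · rw [hT₃ (symProd u₁ w) (symProd u₂ v), hT₃ (symProd u₂ w) (symProd u₀ v),
        hT₃ (symProd u₂ w) (symProd u₁ v)]
      abel
    · rw [hT₂ (symProd u₁ v) (symProd u₂ w), hT₂ (symProd u₂ v) (symProd u₀ w),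
        hT₂ (symProd u₀ v) (symProd u₂ w)]
      abel
  have base : ∀ i j : Fin 3 → m, minorContraction (fun X Y Z => T X Y Z)
      (Pi.single (i 0) 1) (Pi.single (i 1) 1) (Pi.single (i 2) 1)
      (Pi.single (j 0) 1) (Pi.single (j 1) 1) (Pi.single (j 2) 1) = 0 := by
    have inj : ∀ i : Fin 3 → m, i 0 ≠ i 1 → i 0 ≠ i 2 → i 1 ≠ i 2 → Function.Injective i := by
      intro i h1 h2 h3 a b hab
      fin_cases a <;> fin_cases b <;> simp_all
    intro i j
    by_cases i1 : i 0 = i 1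
    · rw [i1]; exact (alt_u _ _ _ _ _).1
    by_cases i2 : i 0 = i 2
    · rw [i2]; exact (alt_u _ _ _ _ _).2.1
    by_cases i3 : i 1 = i 2
    · rw [i3]; exact (alt_u _ _ _ _ _).2.2
    by_cases j1 : j 0 = j 1
    · rw [j1]; exact (alt_w _ _ _ _ _).1
    by_cases j2 : j 0 = j 2
    · rw [j2]; exact (alt_w _ _ _ _ _).2.1
    by_cases j3 : j 1 = j 2
    · rw [j3]; exact (alt_w _ _ _ _ _).2.2
    exact h ⟨i, inj i i1 i2 i3⟩ ⟨j, inj j j1 j2 j3⟩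
  have add_right : ∀ u v w : m → 𝕜, symProd u (v + w) = symProd u v + symProd u w :=
    fun u v w => by simp only [symProd_comm u, symProd_add_left]
  have smul_right : ∀ (a : 𝕜) (u w : m → 𝕜), symProd u (a • w) = a • symProd u w :=
    fun a u w => by simp only [symProd_comm u, symProd_smul_left]
  have zero_left : ∀ u : m → 𝕜, symProd 0 u = 0 := fun u => by
    simpa using symProd_smul_left (0 : 𝕜) 0 u
  have zero_right : ∀ u : m → 𝕜, symProd u 0 = 0 := fun u => by rw [symProd_comm, zero_left]
  have hs : ∀ i₀ i₁ i₂ j₀ j₁ j₂ : m, minorContraction (fun X Y Z => T X Y Z)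
      (Pi.single i₀ 1) (Pi.single i₁ 1) (Pi.single i₂ 1)
      (Pi.single j₀ 1) (Pi.single j₁ 1) (Pi.single j₂ 1) = 0 := fun i₀ i₁ i₂ j₀ j₁ j₂ =>
    base ![i₀, i₁, i₂] ![j₀, j₁, j₂]
  revert u₀ u₁ u₂ w₀ w₁ w₂
  -- The six coordinate vectors are freed one after another, by linearity in each.
  have ext_of : ∀ f : (m → 𝕜) → E, (∀ u v, f (u + v) = f u + f v) →
      (∀ (a : 𝕜) u, f (a • u) = a • f u) → (∀ i, f (Pi.single i 1) = 0) → ∀ u, f u = 0 := by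
    intro f h1 h2 h3
    refine pi_single_induction h3 (fun u v hu hv => by rw [h1, hu, hv, add_zero])
      (fun a u hu => by rw [h2, hu, smul_zero]) ?_
    simpa using h2 0 0
  have l0 : ∀ u₀ i₁ i₂ j₀ j₁ j₂, minorContraction (fun X Y Z => T X Y Z)
      u₀ (Pi.single i₁ 1) (Pi.single i₂ 1)
      (Pi.single j₀ 1) (Pi.single j₁ 1) (Pi.single j₂ 1) = 0 := by
    intro u₀ i₁ i₂ j₀ j₁ j₂
    revert u₀
    refine ext_of _ (fun u v => ?_) (fun a u => ?_) fun i => hs i i₁ i₂ j₀ j₁ j₂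
    all_goals
      simp only [minorContraction, symProd_add_left, symProd_smul_left, map_add, map_smul,
        LinearMap.add_apply, LinearMap.smul_apply]
      module
  have l1 : ∀ u₀ u₁ i₂ j₀ j₁ j₂, minorContraction (fun X Y Z => T X Y Z)
      u₀ u₁ (Pi.single i₂ 1) (Pi.single j₀ 1) (Pi.single j₁ 1) (Pi.single j₂ 1) = 0 := by
    intro u₀ u₁ i₂ j₀ j₁ j₂
    revert u₁
    refine ext_of _ (fun u v => ?_) (fun a u => ?_) fun i => l0 u₀ i i₂ j₀ j₁ j₂
    all_goals
      simp only [minorContraction, symProd_add_left, symProd_smul_left, map_add, map_smul,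
        LinearMap.add_apply, LinearMap.smul_apply]
      module
  have l2 : ∀ u₀ u₁ u₂ j₀ j₁ j₂, minorContraction (fun X Y Z => T X Y Z)
      u₀ u₁ u₂ (Pi.single j₀ 1) (Pi.single j₁ 1) (Pi.single j₂ 1) = 0 := by
    intro u₀ u₁ u₂ j₀ j₁ j₂
    revert u₂
    refine ext_of _ (fun u v => ?_) (fun a u => ?_) fun i => l1 u₀ u₁ i j₀ j₁ j₂
    all_goals
      simp only [minorContraction, symProd_add_left, symProd_smul_left, map_add, map_smul,
        LinearMap.add_apply, LinearMap.smul_apply]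
      module
  have l3 : ∀ u₀ u₁ u₂ w₀ j₁ j₂, minorContraction (fun X Y Z => T X Y Z)
      u₀ u₁ u₂ w₀ (Pi.single j₁ 1) (Pi.single j₂ 1) = 0 := by
    intro u₀ u₁ u₂ w₀ j₁ j₂
    revert w₀
    refine ext_of _ (fun u v => ?_) (fun a u => ?_) fun i => l2 u₀ u₁ u₂ i j₁ j₂
    all_goals
      simp only [minorContraction, add_right, smul_right, map_add, map_smul,
        LinearMap.add_apply, LinearMap.smul_apply]
      module
  have l4 : ∀ u₀ u₁ u₂ w₀ w₁ j₂, minorContraction (fun X Y Z => T X Y Z)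
      u₀ u₁ u₂ w₀ w₁ (Pi.single j₂ 1) = 0 := by
    intro u₀ u₁ u₂ w₀ w₁ j₂
    revert w₁
    refine ext_of _ (fun u v => ?_) (fun a u => ?_) fun i => l3 u₀ u₁ u₂ w₀ i j₂
    all_goals
      simp only [minorContraction, add_right, smul_right, map_add, map_smul,
        LinearMap.add_apply, LinearMap.smul_apply]
      module
  intro u₀ u₁ u₂ w₀ w₁ w₂
  revert w₂
  refine ext_of _ (fun u v => ?_) (fun a u => ?_) fun i => l4 u₀ u₁ u₂ w₀ w₁ i
  all_goals
    simp only [minorContraction, add_right, smul_right, map_add, map_smul,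
      ]
    module

end Extension

/-! ### Exact expansion of the affine symplectic action around a point -/

namespace AffSymp

section Algebra

variable {n : ℕ} {R : Type*} [CommRing R] (g : AffSymp n R)

theorem transpose_mul_a : g.cᵀ * g.a = g.aᵀ * g.c := by
  have h := SymplecticGroup.mem_iff'.1 g.symplectic
  simp only [Matrix.J, Matrix.fromBlocks_transpose, Matrix.fromBlocks_multiply,
    Matrix.fromBlocks_inj] at h
  have h1 := h.1
  simp only [mul_zero, mul_one, mul_neg, zero_add, add_zero, neg_mul] at h1
  rw [← sub_eq_zero, sub_eq_add_neg]; exact h1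

theorem transpose_d_mul_a : g.dᵀ * g.a - g.bᵀ * g.c = 1 := by
  have h := SymplecticGroup.mem_iff'.1 g.symplectic
  simp only [Matrix.J, Matrix.fromBlocks_transpose, Matrix.fromBlocks_multiply,
    Matrix.fromBlocks_inj] at h
  have h1 := h.2.2.1
  simp only [mul_zero, mul_one, mul_neg, zero_add, add_zero, neg_mul] at h1
  rw [sub_eq_add_neg]; exact h1

theorem c_mul_transpose_d : g.c * g.dᵀ = g.d * g.cᵀ := by
  have h := SymplecticGroup.mem_iff.1 g.symplectic
  simp only [Matrix.J, Matrix.fromBlocks_transpose, Matrix.fromBlocks_multiply,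
    Matrix.fromBlocks_inj] at h
  have h1 := h.2.2.2
  simp only [mul_zero, mul_one, mul_neg, zero_add, add_zero, neg_mul] at h1
  rw [← sub_eq_zero, ← neg_eq_zero, ← h1]; abel

variable {g} {T : Matrix (Fin n) (Fin n) R}

/-- Equivalent, after multiplication by cT + d and its transpose, to c dᵀ = d cᵀ. The symmetry is
what the contraction identities require of C. -/
theorem inv_mul_c_isSymm (hT : T.IsSymm) (h : IsUnit (g.c * T + g.d).det) :
    ((g.c * T + g.d)⁻¹ * g.c).IsSymm := by
  have ht : IsUnit ((g.c * T + g.d)ᵀ).det := by rwa [Matrix.det_transpose]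
  have key : g.c * (g.c * T + g.d)ᵀ = (g.c * T + g.d) * g.cᵀ := by
    rw [Matrix.transpose_add, Matrix.transpose_mul, hT.eq, mul_add, add_mul, c_mul_transpose_d,
      mul_assoc]
  unfold Matrix.IsSymm
  rw [Matrix.transpose_mul, Matrix.transpose_nonsing_inv]
  calc g.cᵀ * ((g.c * T + g.d)ᵀ)⁻¹
      = (g.c * T + g.d)⁻¹ * ((g.c * T + g.d) * g.cᵀ) * ((g.c * T + g.d)ᵀ)⁻¹ := by
        rw [Matrix.nonsing_inv_mul_cancel_left _ _ h]
    _ = (g.c * T + g.d)⁻¹ * g.c := by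
        rw [← key, ← mul_assoc, Matrix.mul_nonsing_inv_cancel_right _ _ ht]

/-- Writing the symmetric matrix gT as its own transpose brings the inverse to the left, where the
symplectic relations apply. This is the linear factor by which the action moves both T and τ. -/
theorem a_sub_moebius_mul_c (hT : T.IsSymm) (h : IsUnit (g.c * T + g.d).det) :
    g.a - g.moebius T * g.c = ((g.c * T + g.d)⁻¹)ᵀ := by
  have ht : IsUnit ((g.c * T + g.d)ᵀ).det := by rwa [Matrix.det_transpose]
  have e : g.moebius T = ((g.c * T + g.d)ᵀ)⁻¹ * (g.a * T + g.b)ᵀ := by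
    rw [← (g.moebius_isSymm hT).eq, moebius, Matrix.transpose_mul, Matrix.transpose_nonsing_inv]
  have key : (g.c * T + g.d)ᵀ * g.a - (g.a * T + g.b)ᵀ * g.c = 1 := by
    simp only [Matrix.transpose_add, Matrix.transpose_mul, hT.eq, add_mul, mul_assoc,
      transpose_mul_a]
    rw [← g.transpose_d_mul_a]
    abel
  rw [Matrix.transpose_nonsing_inv, e]
  calc g.a - ((g.c * T + g.d)ᵀ)⁻¹ * (g.a * T + g.b)ᵀ * g.c
      = ((g.c * T + g.d)ᵀ)⁻¹ * ((g.c * T + g.d)ᵀ * g.a - (g.a * T + g.b)ᵀ * g.c) := by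
        rw [mul_sub, Matrix.nonsing_inv_mul_cancel_left _ _ ht, mul_assoc]
    _ = ((g.c * T + g.d)ᵀ)⁻¹ := by rw [key, mul_one]

variable {X : Matrix (Fin n) (Fin n) R}

theorem c_mul_add_add_d (h : IsUnit (g.c * T + g.d).det) :
    g.c * (T + X) + g.d = (g.c * T + g.d) * (1 + (g.c * T + g.d)⁻¹ * g.c * X) := by
  rw [mul_add (g.c * T + g.d), mul_one, mul_assoc _ g.c X, Matrix.mul_nonsing_inv_cancel_left _ _ h]
  noncomm_ring

/-- An identity for finite displacements: multiplying the right side by c(T + X) + d gives a(T + X)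
+ b. -/
theorem moebius_add (hT : T.IsSymm) (h : IsUnit (g.c * T + g.d).det)
    (hX : IsUnit (1 + (g.c * T + g.d)⁻¹ * g.c * X).det) :
    g.moebius (T + X) = g.moebius T + ((g.c * T + g.d)⁻¹)ᵀ *
      (X * (1 + (g.c * T + g.d)⁻¹ * g.c * X)⁻¹) * (g.c * T + g.d)⁻¹ := by
  rw [← a_sub_moebius_mul_c hT h]
  have e : g.a * (T + X) + g.b = (g.moebius T + (g.a - g.moebius T * g.c) *
      (X * (1 + (g.c * T + g.d)⁻¹ * g.c * X)⁻¹) * (g.c * T + g.d)⁻¹) *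
      (g.c * (T + X) + g.d) := by
    have h2 : (g.a - g.moebius T * g.c) * (X * (1 + (g.c * T + g.d)⁻¹ * g.c * X)⁻¹) *
        (g.c * T + g.d)⁻¹ * (g.c * (T + X) + g.d) = (g.a - g.moebius T * g.c) * X := by
      rw [c_mul_add_add_d h, mul_assoc _ _ ((g.c * T + g.d) * _),
        Matrix.nonsing_inv_mul_cancel_left _ _ h, mul_assoc, mul_assoc,
        Matrix.nonsing_inv_mul _ hX, mul_one]
    have h3 : g.moebius T * (g.c * T + g.d) = g.a * T + g.b := by
      rw [moebius, Matrix.nonsing_inv_mul_cancel_right _ _ h]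
    rw [add_mul, h2, mul_add g.c, add_right_comm, mul_add (g.moebius T), h3]
    noncomm_ring
  have hu : IsUnit (g.c * (T + X) + g.d).det := by
    rw [c_mul_add_add_d h, Matrix.det_mul]; exact h.mul hX
  rw [moebius, e, Matrix.mul_nonsing_inv_cancel_right _ _ hu]

end Algebra

section Factorization

variable {n : ℕ} {𝕜 : Type*} [RCLike 𝕜] (g : AffSymp n 𝕜) (x : SymmAff n 𝕜)

/-- The symmetric matrix `(cT + d)⁻¹ c`, bordered by zeros. -/
noncomputable def innerMatrix : Matrix (Fin n ⊕ Unit) (Fin n ⊕ Unit) 𝕜 :=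
  Matrix.fromBlocks ((g.c * (x.1 : Matrix (Fin n) (Fin n) 𝕜) + g.d)⁻¹ * g.c) 0 0 0

/-- The matrix with rows `(((cT + d)⁻¹)ᵀ, 0)` and `(-((cT + d)⁻¹ (cτ + s))ᵀ, 1)`. -/
noncomputable def outerMatrix : Matrix (Fin n ⊕ Unit) (Fin n ⊕ Unit) 𝕜 :=
  Matrix.fromBlocks ((g.c * (x.1 : Matrix (Fin n) (Fin n) 𝕜) + g.d)⁻¹)ᵀ 0
    (Matrix.replicateRow Unit
      (-((g.c * (x.1 : Matrix (Fin n) (Fin n) 𝕜) + g.d)⁻¹ *ᵥ (g.c *ᵥ x.2 + g.s)))) 1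

variable {g x}

theorem innerMatrix_isSymm (hx : g.autDet x ≠ 0) : (g.innerMatrix x).IsSymm := by
  have h := inv_mul_c_isSymm x.1.2 (isUnit_iff_ne_zero.2 hx)
  simp only [Matrix.IsSymm, innerMatrix, Matrix.fromBlocks_transpose, h.eq, Matrix.transpose_zero]

theorem exists_fromBlocks_of_isSymm {Z : Matrix (Fin n ⊕ Unit) (Fin n ⊕ Unit) 𝕜} (hZ : Z.IsSymm) :
    Z = Matrix.fromBlocks ((blockProj Z).1 : Matrix (Fin n) (Fin n) 𝕜)
      (Matrix.replicateCol Unit (blockProj Z).2) (Matrix.replicateRow Unit (blockProj Z).2)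
      Z.toBlocks₂₂ := by
  obtain ⟨h1, h2⟩ := blockProj_of_isSymm hZ
  rw [h1, h2]
  ext i j
  rcases i with i | i <;> rcases j with j | j
  · rfl
  · rfl
  · exact hZ.apply _ _
  · rfl

theorem one_add_innerMatrix_mul {Z : Matrix (Fin n ⊕ Unit) (Fin n ⊕ Unit) 𝕜} (hZ : Z.IsSymm) :
    1 + g.innerMatrix x * Z = Matrix.fromBlocks
      (1 + (g.c * (x.1 : Matrix (Fin n) (Fin n) 𝕜) + g.d)⁻¹ * g.c *
        ((blockProj Z).1 : Matrix (Fin n) (Fin n) 𝕜))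
      ((g.c * (x.1 : Matrix (Fin n) (Fin n) 𝕜) + g.d)⁻¹ * g.c *
        Matrix.replicateCol Unit (blockProj Z).2) 0 1 := by
  conv_lhs => rw [exists_fromBlocks_of_isSymm hZ]
  rw [innerMatrix, Matrix.fromBlocks_multiply, ← Matrix.fromBlocks_one, Matrix.fromBlocks_add]
  simp

theorem autDet_add_blockProj (hx : g.autDet x ≠ 0) {Z : Matrix (Fin n ⊕ Unit) (Fin n ⊕ Unit) 𝕜}
    (hZ : Z.IsSymm) :
    g.autDet (x + blockProj Z) = g.autDet x * (1 + g.innerMatrix x * Z).det := by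
  rw [one_add_innerMatrix_mul hZ, Matrix.det_fromBlocks_zero₂₁, Matrix.det_one, mul_one, autDet,
    autDet, ← Matrix.det_mul, ← c_mul_add_add_d (isUnit_iff_ne_zero.2 hx)]
  rfl

/-- The corner entry `z` influences neither of these two blocks, so ignoring the corner is
compatible with the action. -/
theorem blocks_outer_conj {R : Type*} [CommRing R] (j X B K : Matrix (Fin n) (Fin n) R)
    (ξ q : Fin n → R) (z : Matrix Unit Unit R) :
    (Matrix.fromBlocks jᵀ 0 (Matrix.replicateRow Unit (-q)) 1 *
      (Matrix.fromBlocks X (Matrix.replicateCol Unit ξ) (Matrix.replicateRow Unit ξ) z *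
        Matrix.fromBlocks B (-(B * (K * Matrix.replicateCol Unit ξ))) 0 1) *
      (Matrix.fromBlocks jᵀ 0 (Matrix.replicateRow Unit (-q)) 1)ᵀ).toBlocks₁₁ = jᵀ * (X * B) * j ∧
    (Matrix.fromBlocks jᵀ 0 (Matrix.replicateRow Unit (-q)) 1 *
      (Matrix.fromBlocks X (Matrix.replicateCol Unit ξ) (Matrix.replicateRow Unit ξ) z *
        Matrix.fromBlocks B (-(B * (K * Matrix.replicateCol Unit ξ))) 0 1) *
      (Matrix.fromBlocks jᵀ 0 (Matrix.replicateRow Unit (-q)) 1)ᵀ).toBlocks₁₂ =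
      Matrix.replicateCol Unit (jᵀ *ᵥ (ξ - (X * B) *ᵥ (K *ᵥ ξ + q))) := by
  rw [Matrix.fromBlocks_transpose, Matrix.fromBlocks_multiply, Matrix.fromBlocks_multiply,
    Matrix.fromBlocks_multiply, Matrix.toBlocks_fromBlocks₁₁, Matrix.toBlocks_fromBlocks₁₂]
  constructor
  · simp
  · have hneg : ∀ v : Fin n → R, Matrix.replicateCol Unit (-v) = -Matrix.replicateCol Unit v :=
      fun _ => rfl
    simp only [sub_eq_add_neg, Matrix.replicateCol_mulVec, Matrix.replicateCol_add, hneg,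
      Matrix.transpose_replicateRow, Matrix.transpose_one, Matrix.mul_zero, Matrix.zero_mul,
      add_zero, Matrix.mul_one, Matrix.mul_add, Matrix.mul_neg, Matrix.mul_assoc]
    abel

/-- The border turns the joint motion of T and τ into a single fractional linear map followed by a
congruence. The vector s enters only through the last row of the outer matrix, and r cancels because
displacements are compared. -/
theorem act_add_blockProj (hx : g.autDet x ≠ 0) {Z : Matrix (Fin n ⊕ Unit) (Fin n ⊕ Unit) 𝕜}
    (hZ : Z.IsSymm) (hd : (1 + g.innerMatrix x * Z).det ≠ 0) :
    g.act (x + blockProj Z) = g.act x + blockProj (g.outerMatrix x *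
      (Z * (1 + g.innerMatrix x * Z)⁻¹) * (g.outerMatrix x)ᵀ) := by
  have hu := isUnit_iff_ne_zero.2 hx
  have hC := g.innerMatrix_isSymm hx
  have hM : (Z * (1 + g.innerMatrix x * Z)⁻¹).IsSymm := by
    have hud := isUnit_iff_ne_zero.2 hd
    have hud' : IsUnit ((1 + g.innerMatrix x * Z)ᵀ).det := by rwa [Matrix.det_transpose]
    unfold Matrix.IsSymm
    rw [Matrix.transpose_mul, hZ.eq, Matrix.transpose_nonsing_inv]
    have key : Z * (1 + g.innerMatrix x * Z) = (1 + g.innerMatrix x * Z)ᵀ * Z := by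
      rw [Matrix.transpose_add, Matrix.transpose_mul, hZ.eq, hC.eq, Matrix.transpose_one]
      noncomm_ring
    calc ((1 + g.innerMatrix x * Z)ᵀ)⁻¹ * Z
        = ((1 + g.innerMatrix x * Z)ᵀ)⁻¹ * (Z * (1 + g.innerMatrix x * Z)) *
          (1 + g.innerMatrix x * Z)⁻¹ := by
            rw [mul_assoc, Matrix.mul_nonsing_inv_cancel_right _ _ hud]
      _ = _ := by rw [key, Matrix.nonsing_inv_mul_cancel_left _ _ hud']
  have hP : (g.outerMatrix x * (Z * (1 + g.innerMatrix x * Z)⁻¹) * (g.outerMatrix x)ᵀ).IsSymm := by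
    unfold Matrix.IsSymm
    rw [Matrix.transpose_mul, Matrix.transpose_mul, Matrix.transpose_transpose, hM.eq, ← mul_assoc]
  have hone := one_add_innerMatrix_mul (g := g) (x := x) hZ
  have hd1 : IsUnit (1 + (g.c * (x.1 : Matrix (Fin n) (Fin n) 𝕜) + g.d)⁻¹ * g.c *
        ((blockProj Z).1 : Matrix (Fin n) (Fin n) 𝕜)).det := by
    rw [hone, Matrix.det_fromBlocks_zero₂₁, Matrix.det_one, mul_one] at hd
    exact isUnit_iff_ne_zero.2 hd
  have hm := moebius_add (g := g) x.1.2 hu hd1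
  have ha := a_sub_moebius_mul_c (g := g) x.1.2 hu
  obtain ⟨p1, p2⟩ := blockProj_of_isSymm hP
  have hinv : (1 + g.innerMatrix x * Z)⁻¹ = Matrix.fromBlocks
      (1 + (g.c * (x.1 : Matrix (Fin n) (Fin n) 𝕜) + g.d)⁻¹ * g.c *
        ((blockProj Z).1 : Matrix (Fin n) (Fin n) 𝕜))⁻¹
      (-((1 + (g.c * (x.1 : Matrix (Fin n) (Fin n) 𝕜) + g.d)⁻¹ * g.c *
        ((blockProj Z).1 : Matrix (Fin n) (Fin n) 𝕜))⁻¹ *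
        ((g.c * (x.1 : Matrix (Fin n) (Fin n) 𝕜) + g.d)⁻¹ * g.c *
        Matrix.replicateCol Unit (blockProj Z).2))) 0 1 := by
    refine Matrix.inv_eq_right_inv ?_
    rw [hone, Matrix.fromBlocks_multiply, ← Matrix.fromBlocks_one]
    congr 1
    · rw [Matrix.mul_zero, add_zero, Matrix.mul_nonsing_inv _ hd1]
    · rw [Matrix.mul_neg, Matrix.mul_nonsing_inv_cancel_left _ _ hd1, Matrix.mul_one,
        neg_add_cancel]
    · simp
    · simp
  obtain ⟨r1, r2⟩ := blocks_outer_conj ((g.c * (x.1 : Matrix (Fin n) (Fin n) 𝕜) + g.d)⁻¹)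
    ((blockProj Z).1 : Matrix (Fin n) (Fin n) 𝕜)
    ((1 + (g.c * (x.1 : Matrix (Fin n) (Fin n) 𝕜) + g.d)⁻¹ * g.c *
        ((blockProj Z).1 : Matrix (Fin n) (Fin n) 𝕜))⁻¹)
    ((g.c * (x.1 : Matrix (Fin n) (Fin n) 𝕜) + g.d)⁻¹ * g.c) (blockProj Z).2
    ((g.c * (x.1 : Matrix (Fin n) (Fin n) 𝕜) + g.d)⁻¹ *ᵥ (g.c *ᵥ x.2 + g.s)) Z.toBlocks₂₂
  rw [← hinv, ← outerMatrix, ← exists_fromBlocks_of_isSymm hZ] at r1 r2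
  rw [r1] at p1
  have q1 : (g.act (x + blockProj Z)).1 = (g.act x).1 + (blockProj (g.outerMatrix x *
      (Z * (1 + g.innerMatrix x * Z)⁻¹) * (g.outerMatrix x)ᵀ)).1 := by
    apply Subtype.ext
    rw [Submodule.coe_add, p1]
    exact hm
  refine Prod.ext q1 ?_
  have p2' := p2.trans (funext fun i => congrFun (congrFun r2 i) ())
  rw [Prod.snd_add, p2']
  change g.a *ᵥ (x.2 + (blockProj Z).2) + g.r -
    g.moebius (x.1 + (blockProj Z).1) *ᵥ (g.c *ᵥ (x.2 + (blockProj Z).2) + g.s) =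
    g.a *ᵥ x.2 + g.r - g.moebius x.1 *ᵥ (g.c *ᵥ x.2 + g.s) +
      ((g.c * (x.1 : Matrix (Fin n) (Fin n) 𝕜) + g.d)⁻¹)ᵀ *ᵥ _
  rw [hm]
  -- Splits aξ so that the part (gT)cξ cancels against the shift of τ in the last summand of the
  -- action.
  have hav : g.a *ᵥ (blockProj Z).2 = g.moebius x.1 *ᵥ g.c *ᵥ (blockProj Z).2 +
      ((g.c * (x.1 : Matrix (Fin n) (Fin n) 𝕜) + g.d)⁻¹)ᵀ *ᵥ (blockProj Z).2 := by
    rw [← ha, Matrix.sub_mulVec, Matrix.mulVec_mulVec]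
    abel
  rw [Matrix.mulVec_add g.a, hav]
  simp only [Matrix.mulVec_add, Matrix.mulVec_sub, Matrix.add_mulVec, Matrix.mulVec_mulVec,
    add_mul, mul_assoc]
  abel

end Factorization

end AffSymp

/-! ### Covariance of the flat system -/

namespace AffSymp

open Filter Topology

section Smooth

variable {n : ℕ} {𝕜 : Type*} [RCLike 𝕜] {g : AffSymp n 𝕜} {x : SymmAff n 𝕜} {k : ℕ∞ω}

theorem contDiffAt_subtype_iff {W : Type*} [NormedAddCommGroup W] [NormedSpace 𝕜 W]
    {f : W → SymmMat n 𝕜} {x : W} :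
    ContDiffAt 𝕜 k f x ↔ ContDiffAt 𝕜 k (fun y => (f y : Matrix (Fin n) (Fin n) 𝕜)) x := by
  refine ⟨fun h => (SymmMat n 𝕜).subtypeL.contDiff.contDiffAt.comp x h, fun h => ?_⟩
  obtain ⟨r, hr⟩ := (SymmMat n 𝕜).subtype.exists_leftInverse_of_injective
    (Submodule.ker_subtype _)
  have h1 := (LinearMap.toContinuousLinearMap r).contDiff.contDiffAt.comp x h
  exact h1.congr_of_eventuallyEq (.of_forall fun y => (LinearMap.congr_fun hr (f y)).symm)

theorem contDiffAt_coe_fst : ContDiffAt 𝕜 k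
    (fun y : SymmAff n 𝕜 => (y.1 : Matrix (Fin n) (Fin n) 𝕜)) x :=
  contDiffAt_subtype_iff.1 contDiffAt_fst

theorem contDiffAt_autMatrix : ContDiffAt 𝕜 k
    (fun y : SymmAff n 𝕜 => g.c * (y.1 : Matrix (Fin n) (Fin n) 𝕜) + g.d) x :=
  (contDiffAt_const.matrix_mul contDiffAt_coe_fst).add contDiffAt_const

theorem contDiffAt_autDet : ContDiffAt 𝕜 k g.autDet x :=
  contDiffAt_autMatrix.matrix_det

theorem contDiffAt_act (hx : g.autDet x ≠ 0) : ContDiffAt 𝕜 k g.act x := by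
  have hm : ContDiffAt 𝕜 k
      (fun y : SymmAff n 𝕜 => g.moebius (y.1 : Matrix (Fin n) (Fin n) 𝕜)) x :=
    ((contDiffAt_const.matrix_mul contDiffAt_coe_fst).add contDiffAt_const).matrix_mul
      (contDiffAt_autMatrix.matrix_inv hx)
  refine ContDiffAt.prodMk (contDiffAt_subtype_iff.2 hm) ?_
  exact ((contDiffAt_const.matrix_mulVec contDiffAt_snd).add contDiffAt_const).sub
    (hm.matrix_mulVec ((contDiffAt_const.matrix_mulVec contDiffAt_snd).add contDiffAt_const))

theorem isOpen_domain {U : Set (SymmAff n 𝕜)} (hU : IsOpen U) : IsOpen (g.domain U) := by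
  rw [isOpen_iff_mem_nhds]
  rintro x ⟨hx, hxU⟩
  have h1 := (contDiffAt_autDet (k := 0) (g := g) (x := x)).continuousAt.eventually_ne hx
  have h2 := (contDiffAt_act (k := 0) hx).continuousAt.eventually (hU.mem_nhds hxU)
  filter_upwards [h1, h2] with y h1 h2 using ⟨h1, h2⟩

variable {E : Type*} [NormedAddCommGroup E] [NormedSpace 𝕜 E]

theorem contDiffAt_transform {G : SymmAff n 𝕜 → E} (hx : g.autDet x ≠ 0)
    (hG : ContDiffAt 𝕜 k G (g.act x)) : ContDiffAt 𝕜 k (g.transform G) x :=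
  (contDiffAt_autDet.inv hx).smul (hG.comp x (contDiffAt_act hx))

/-- Covariance of the determinantal system at a point. -/
theorem detMinor_eq_zero_of_eventuallyEq_transform {F G : SymmAff n 𝕜 → E} (hx : g.autDet x ≠ 0)
    (hG : ContDiffAt 𝕜 3 G (g.act x))
    (hG0 : ∀ I J : Fin 3 ↪ Fin n ⊕ Unit, detMinor 𝕜 I J G (g.act x) = 0) (κ : 𝕜)
    (hF : F =ᶠ[𝓝 x] fun y => κ • g.transform G y) (I J : Fin 3 ↪ Fin n ⊕ Unit) :
    detMinor 𝕜 I J F x = 0 := by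
  have hFc : ContDiffAt 𝕜 3 F x :=
    ((contDiffAt_transform hx hG).const_smul κ).congr_of_eventuallyEq hF
  rw [detMinor_eq_minorContraction hFc]
  have hGu := minorContraction_eq_zero_of_single (thirdDerivComp G (g.act x) blockProj)
    (fun X Y Z => by rw [thirdDerivComp_apply, thirdDerivComp_apply, fderiv_three_comm_left hG])
    (fun X Y Z => by rw [thirdDerivComp_apply, thirdDerivComp_apply, fderiv_three_comm_right hG])
    (fun I J => by rw [← detMinor_eq_minorContraction hG, hG0])
  set P := g.outerMatrix x with hP
  -- Congruence by `P` carries symmetric products to symmetric products. The minors of `G` are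
  -- therefore used at the vectors `P u` and `P w`.
  let conj : Matrix (Fin n ⊕ Unit) (Fin n ⊕ Unit) 𝕜 →ₗ[𝕜] Matrix (Fin n ⊕ Unit) (Fin n ⊕ Unit) 𝕜 :=
    { toFun := fun X => P * X * Pᵀ
      map_add' := fun X Y => by rw [mul_add, add_mul]
      map_smul' := fun a X => by
        rw [Matrix.mul_smul, Matrix.smul_mul, RingHom.id_apply] }
  have hconj : ∀ X, conj X = P * X * Pᵀ := fun _ => rfl
  have hsym : ∀ u w, conj (symProd u w) = symProd (P *ᵥ u) (P *ᵥ w) := by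
    intro u w
    simp only [hconj, symProd, mul_add, add_mul, Matrix.mul_vecMulVec, Matrix.vecMulVec_mul,
      Matrix.vecMul_transpose]
  refine minorContraction_thirdDerivComp_eq_zero hFc hG blockProj (blockProj ∘ₗ conj) ?_
    (innerMatrix_isSymm hx) (κ * (g.autDet x)⁻¹) ?_ ?_ _ _ _ _ _ _
  · intro X
    rw [LinearMap.comp_apply, LinearMap.comp_apply, ← blockProj_transpose, hconj, hconj]
    simp only [Matrix.transpose_mul, Matrix.transpose_transpose, mul_assoc]
  · intro Z hZ
    have hlim : Tendsto (fun t : 𝕜 => x + t • blockProj Z) (𝓝 0) (𝓝 x) := by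
      have : Continuous fun t : 𝕜 => x + t • blockProj Z := by fun_prop
      simpa using this.tendsto 0
    filter_upwards [hlim.eventually hF,
      eventually_det_one_add_smul_ne_zero (g.innerMatrix x * Z)] with t h1 h2
    have hZt : (t • Z).IsSymm := hZ.smul t
    have h3 : t • (g.innerMatrix x * Z) = g.innerMatrix x * (t • Z) := by
      rw [Matrix.mul_smul]
    rw [h3] at h2 ⊢
    rw [h1, transform, ← map_smul, autDet_add_blockProj hx hZt, act_add_blockProj hx hZt h2,
      smul_smul, mul_inv, ← mul_assoc]
    rfl
  · intro u₀ u₁ u₂ w₀ w₁ w₂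
    have := hGu (P *ᵥ u₀) (P *ᵥ u₁) (P *ᵥ u₂) (P *ᵥ w₀) (P *ᵥ w₁) (P *ᵥ w₂)
    simp only [minorContraction, thirdDerivComp_apply, LinearMap.comp_apply, hsym] at this ⊢
    exact this

/-- The scalar may depend on the point: this admits factors that are only locally constant, such as
the sign of a determinant. -/
theorem solvesDet_of_eventuallyEq_transform {U D : Set (SymmAff n 𝕜)} {F G : SymmAff n 𝕜 → E}
    (hG : ∀ y ∈ U, ContDiffAt 𝕜 3 G y) (hG0 : SolvesDet 𝕜 U G) (hD : D ⊆ g.domain U)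
    (hF : ∀ x ∈ D, ∃ κ : 𝕜, F =ᶠ[𝓝 x] fun y => κ • g.transform G y) : SolvesDet 𝕜 D F := by
  intro I J x hx
  obtain ⟨κ, hκ⟩ := hF x hx
  exact detMinor_eq_zero_of_eventuallyEq_transform (hD hx).1 (hG _ (hD hx).2)
    (fun I J => hG0 I J _ (hD hx).2) κ hκ I J

end Smooth

section Solutions

variable {n : ℕ}

theorem isHolSolution_transform (g : AffSymp n ℂ) {U : Set (SymmAff n ℂ)} {G : SymmAff n ℂ → ℂ}
    (h : IsHolSolution U G) : IsHolSolution (g.domain U) (g.transform G) := by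
  obtain ⟨hU, hG, hs⟩ := h
  refine ⟨isOpen_domain hU, fun x hx => ?_, ?_⟩
  · exact (contDiffAt_transform (k := ω) hx.1 (hG _ hx.2).contDiffAt).analyticAt
  · exact solvesDet_of_eventuallyEq_transform (fun y hy => (hG y hy).contDiffAt) hs subset_rfl
      fun x _ => ⟨1, by simp only [one_smul]; rfl⟩

variable {E : Type*} [NormedAddCommGroup E] [NormedSpace ℝ E]

theorem isSmoothSolution_of_eventuallyEq_transform (g : AffSymp n ℝ) {U : Set (SymmAff n ℝ)}
    {F G : SymmAff n ℝ → E} (h : IsSmoothSolution U G)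
    (hF : ∀ x ∈ g.domain U, ∃ κ : ℝ, F =ᶠ[𝓝 x] fun y => κ • g.transform G y) :
    IsSmoothSolution (g.domain U) F := by
  obtain ⟨hU, hG, hs⟩ := h
  have hGa : ∀ y ∈ U, ContDiffAt ℝ ∞ G y := fun y hy => hG.contDiffAt (hU.mem_nhds hy)
  refine ⟨isOpen_domain hU, fun x hx => ?_, ?_⟩
  · obtain ⟨κ, hκ⟩ := hF x hx
    exact (((contDiffAt_transform hx.1 (hGa _ hx.2)).const_smul κ).congr_of_eventuallyEq
      hκ).contDiffWithinAt
  · exact solvesDet_of_eventuallyEq_transform (fun y hy => (hGa y hy).of_le (by norm_cast)) hs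
      subset_rfl hF

theorem rhoFlat_eventuallyEq (g : AffSymp n ℝ) (G : SymmAff n ℝ → E) {x : SymmAff n ℝ}
    (hx : g.autDet x ≠ 0) :
    ∃ κ : ℝ, g.rhoFlat G =ᶠ[𝓝 x] fun y => κ • g.transform G y := by
  have hc := (contDiffAt_autDet (k := 0) (g := g) (x := x)).continuousAt
  rcases hx.lt_or_gt with h | h
  · refine ⟨-1, (hc.eventually_lt_const h).mono fun y hy => ?_⟩
    simp only [rhoFlat, transform, abs_of_neg hy, inv_neg, neg_smul, one_smul]
  · refine ⟨1, (hc.eventually_const_lt h).mono fun y hy => ?_⟩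
    simp only [rhoFlat, transform, abs_of_pos hy, one_smul]

end Solutions

end AffSymp

/-! ### The group action on the compact model -/

theorem Matrix.IsSymm.conjTranspose_eq_map {m R : Type*} [Star R] {S : Matrix m m R}
    (hS : S.IsSymm) : Sᴴ = S.map star := by
  rw [Matrix.conjTranspose, hS.eq]

theorem Matrix.map_star_mul {m R : Type*} [Fintype m] [CommRing R] [StarRing R]
    (A B : Matrix m m R) : (A * B).map star = A.map star * B.map star := by
  ext i j
  simp [Matrix.mul_apply]

theorem Matrix.map_star_add {m R : Type*} [CommRing R] [StarRing R]
    (A B : Matrix m m R) : (A + B).map star = A.map star + B.map star := by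
  ext i j
  simp

theorem Matrix.map_star_map_star {m R : Type*} [CommRing R] [StarRing R] (A : Matrix m m R) :
    (A.map star).map star = A := by
  ext i j
  simp

theorem Matrix.map_star_one {m R : Type*} [DecidableEq m] [CommRing R] [StarRing R] :
    (1 : Matrix m m R).map star = 1 :=
  Matrix.map_one _ (star_zero _) (star_one _)

theorem Matrix.star_mulVec_eq {m R : Type*} [Fintype m] [CommRing R] [StarRing R]
    (A : Matrix m m R) (v : m → R) : star (A *ᵥ v) = A.map star *ᵥ star v := by
  ext i
  simp [Matrix.mulVec, dotProduct]

theorem Matrix.det_map_star {m R : Type*} [Fintype m] [DecidableEq m] [CommRing R] [StarRing R]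
    (A : Matrix m m R) : (A.map star).det = star A.det := by
  rw [← Matrix.det_conjTranspose, Matrix.conjTranspose, Matrix.transpose_map,
    Matrix.det_transpose]

namespace AffSympComp

variable {n : ℕ} {x : SymmAff n ℂ}

theorem mem_compactModel_iff : x ∈ compactModel n ↔
    (x.1 : Matrix (Fin n) (Fin n) ℂ) * (x.1 : Matrix (Fin n) (Fin n) ℂ).map star = 1 ∧
      x.2 = -((x.1 : Matrix (Fin n) (Fin n) ℂ) *ᵥ star x.2) := by
  have hs : star (x.1 : Matrix (Fin n) (Fin n) ℂ) = (x.1 : Matrix (Fin n) (Fin n) ℂ).map star :=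
    Matrix.IsSymm.conjTranspose_eq_map x.1.2
  simp only [compactModel, Set.mem_ofPred_eq, Matrix.mem_unitaryGroup_iff, hs]

variable (g : AffSympComp n)

/-- The numerator `ΦS + Ψ` of the fractional linear transformation. -/
def num (x : SymmAff n ℂ) : Matrix (Fin n) (Fin n) ℂ :=
  g.Φ * (x.1 : Matrix (Fin n) (Fin n) ℂ) + g.Ψ

/-- The denominator `Ψ'S + Φ'` of the fractional linear transformation. -/
def den (x : SymmAff n ℂ) : Matrix (Fin n) (Fin n) ℂ :=
  g.Ψ.map star * (x.1 : Matrix (Fin n) (Fin n) ℂ) + g.Φ.map star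

theorem autDet_eq : g.toAffSymp.autDet x = (g.den x).det := rfl

theorem act_fst : ((g.toAffSymp.act x).1 : Matrix (Fin n) (Fin n) ℂ) = g.num x * (g.den x)⁻¹ := rfl

variable {g}

/-- On the compact model S̄ inverts S, so conjugation exchanges numerator and denominator up to the
factor S̄. The invariance of the model and the formula for |det|² both come from this. -/
theorem den_map_star (hx : x ∈ compactModel n) :
    (g.den x).map star = g.num x * (x.1 : Matrix (Fin n) (Fin n) ℂ).map star := by
  rw [den, num, Matrix.map_star_add, Matrix.map_star_mul, Matrix.map_star_map_star,
    Matrix.map_star_map_star, add_mul, mul_assoc, (mem_compactModel_iff.1 hx).1, mul_one, add_comm]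

theorem num_map_star (hx : x ∈ compactModel n) :
    (g.num x).map star = g.den x * (x.1 : Matrix (Fin n) (Fin n) ℂ).map star := by
  rw [den, num, Matrix.map_star_add, Matrix.map_star_mul, add_mul, mul_assoc,
    (mem_compactModel_iff.1 hx).1, mul_one, add_comm]

theorem den_transpose_mul_num : (g.den x)ᵀ * g.num x = (g.num x)ᵀ * g.den x := by
  have h := SymplecticGroup.mem_iff'.1 g.symplectic
  simp only [Matrix.J, Matrix.fromBlocks_transpose, Matrix.fromBlocks_multiply,
    Matrix.fromBlocks_inj] at h
  obtain ⟨h1, h2, h3, h4⟩ := h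
  simp only [mul_zero, mul_one, mul_neg, zero_add, add_zero, neg_mul] at h1 h2 h3 h4
  have hT : (x.1 : Matrix (Fin n) (Fin n) ℂ)ᵀ = x.1 := x.1.2
  simp only [den, num, Matrix.transpose_add, Matrix.transpose_mul, hT]
  rw [← sub_eq_zero]
  have e : ∀ S A B C D A' B' C' D' : Matrix (Fin n) (Fin n) ℂ,
      (S * C' + D') * (A * S + B) - (S * A' + B') * (C * S + D) =
      S * (C' * A + -(A' * C)) * S + S * (C' * B + -(A' * D)) + (D' * A + -(B' * C)) * S
        + (D' * B + -(B' * D)) := by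
    intros; noncomm_ring
  rw [e, h1, h2, h3, h4]
  simp

theorem eq_transpose_mul_num_sub : (g.Φ.map star)ᵀ * g.num x - g.Ψᵀ * g.den x = x.1 := by
  have h := SymplecticGroup.mem_iff'.1 g.symplectic
  simp only [Matrix.J, Matrix.fromBlocks_transpose, Matrix.fromBlocks_multiply,
    Matrix.fromBlocks_inj] at h
  obtain ⟨h1, h2, h3, h4⟩ := h
  simp only [mul_zero, mul_one, mul_neg, zero_add, add_zero, neg_mul] at h1 h2 h3 h4
  have e : ∀ S A B C D B' D' : Matrix (Fin n) (Fin n) ℂ,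
      D' * (A * S + B) - B' * (C * S + D) = (D' * A + -(B' * C)) * S + (D' * B + -(B' * D)) := by
    intros; noncomm_ring
  rw [num, den, e, h3, h4, one_mul, add_zero]

-- If the denominator N kills v, then so does the numerator M, because M*M = S̄ MᵀN. By the
-- symplectic relations S is a combination of M and N, so Sv = 0, and v = 0 since S is invertible.
open scoped ComplexOrder in
theorem autDet_ne_zero (hx : x ∈ compactModel n) : g.toAffSymp.autDet x ≠ 0 := by
  rw [autDet_eq]
  intro h
  obtain ⟨v, hv, hv0⟩ := Matrix.exists_mulVec_eq_zero_iff.2 h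
  refine hv ?_
  have hS := (mem_compactModel_iff.1 hx).1
  have hnum : (g.num x)ᴴ * g.num x = (x.1 : Matrix (Fin n) (Fin n) ℂ).map star *
      ((g.num x)ᵀ * g.den x) := by
    have hT : ((x.1 : Matrix (Fin n) (Fin n) ℂ).map star)ᵀ =
        (x.1 : Matrix (Fin n) (Fin n) ℂ).map star := by
      rw [← Matrix.transpose_map, show (x.1 : Matrix (Fin n) (Fin n) ℂ)ᵀ = x.1 from x.1.2]
    rw [Matrix.conjTranspose, Matrix.transpose_map, num_map_star hx, Matrix.transpose_mul, hT,
      mul_assoc, den_transpose_mul_num]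
  have h1 : (g.num x) *ᵥ v = 0 := by
    rw [← Matrix.conjTranspose_mul_self_mulVec_eq_zero, hnum, ← Matrix.mulVec_mulVec,
      ← Matrix.mulVec_mulVec, hv0]
    simp
  have h2 : (x.1 : Matrix (Fin n) (Fin n) ℂ) *ᵥ v = 0 := by
    rw [← eq_transpose_mul_num_sub (g := g), Matrix.sub_mulVec, ← Matrix.mulVec_mulVec,
      ← Matrix.mulVec_mulVec, h1, hv0]
    simp
  rw [← Matrix.one_mulVec v, ← mul_eq_one_comm.1 hS, ← Matrix.mulVec_mulVec, h2,
    Matrix.mulVec_zero]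

theorem det_ne_zero_of_mem (hx : x ∈ compactModel n) :
    (x.1 : Matrix (Fin n) (Fin n) ℂ).det ≠ 0 := by
  have h := congrArg Matrix.det (mem_compactModel_iff.1 hx).1
  rw [Matrix.det_mul, Matrix.det_one] at h
  exact left_ne_zero_of_mul_eq_one h

theorem det_num (hx : x ∈ compactModel n) :
    (g.num x).det = star (g.den x).det * (x.1 : Matrix (Fin n) (Fin n) ℂ).det := by
  have h1 := congrArg Matrix.det (den_map_star (g := g) hx)
  have h2 := congrArg Matrix.det (mem_compactModel_iff.1 hx).1
  rw [Matrix.det_mul, Matrix.det_one] at h2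
  rw [Matrix.det_map_star, Matrix.det_mul] at h1
  rw [h1, mul_assoc, mul_comm (Matrix.det (Matrix.map _ _)), h2, mul_one]

theorem act_mem_compactModel (hx : x ∈ compactModel n) :
    g.toAffSymp.act x ∈ compactModel n := by
  have hd : IsUnit (g.den x).det := isUnit_iff_ne_zero.2 (autDet_ne_zero hx)
  have hn : IsUnit (g.num x).det := by
    rw [isUnit_iff_ne_zero, det_num hx]
    exact mul_ne_zero (star_ne_zero.2 hd.ne_zero) (det_ne_zero_of_mem hx)
  obtain ⟨hS, hσ⟩ := mem_compactModel_iff.1 hx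
  -- Conjugating the quotient of numerator by denominator inverts it, which is unitarity of the
  -- image.
  have hconj : (g.num x * (g.den x)⁻¹).map star = g.den x * (g.num x)⁻¹ := by
    have h1 : (g.num x * (g.den x)⁻¹).map star * (g.den x).map star = (g.num x).map star := by
      rw [← Matrix.map_star_mul, Matrix.nonsing_inv_mul_cancel_right _ _ hd]
    rw [den_map_star hx, num_map_star hx] at h1
    have h2 := congrArg (fun A => A * (x.1 : Matrix (Fin n) (Fin n) ℂ) * (g.num x)⁻¹) h1
    have hS' := mul_eq_one_comm.1 hS
    simp only [mul_assoc] at h2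
    rw [← mul_assoc ((x.1 : Matrix (Fin n) (Fin n) ℂ).map star), hS', one_mul,
      Matrix.mul_nonsing_inv _ hn, mul_one] at h2
    exact h2
  have hSS : (g.num x * (g.den x)⁻¹) * (g.den x * (g.num x)⁻¹) = 1 := by
    rw [mul_assoc, Matrix.nonsing_inv_mul_cancel_left _ _ hd, Matrix.mul_nonsing_inv _ hn]
  refine mem_compactModel_iff.2 ⟨?_, ?_⟩
  · rw [act_fst, hconj, hSS]
  · have e2 : (g.toAffSymp.act x).2 = g.Φ *ᵥ x.2 + g.p -
        (g.num x * (g.den x)⁻¹) *ᵥ (g.Ψ.map star *ᵥ x.2 + star g.p) := rfl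
    have e3 : star (g.toAffSymp.act x).2 = g.Φ.map star *ᵥ star x.2 + star g.p -
        (g.den x * (g.num x)⁻¹) *ᵥ (g.Ψ *ᵥ star x.2 + g.p) := by
      rw [e2]
      simp only [star_sub, star_add, Matrix.star_mulVec_eq, star_star, hconj,
        Matrix.map_star_map_star]
    have e4 : (g.num x * (g.den x)⁻¹) *ᵥ (g.den x *ᵥ star x.2) = g.num x *ᵥ star x.2 := by
      rw [Matrix.mulVec_mulVec, Matrix.nonsing_inv_mul_cancel_right _ _ hd]
    -- The relation σ = -Sσ̄ turns combinations of σ and σ̄ into the numerator or the denominator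
    -- applied to σ̄; the translation parts cancel separately.
    have e5 : g.Φ *ᵥ x.2 - g.Ψ *ᵥ star x.2 = -(g.num x *ᵥ star x.2) := by
      generalize star x.2 = w at *
      rw [hσ, num, Matrix.add_mulVec, Matrix.mulVec_neg, Matrix.mulVec_mulVec]
      abel
    have e6 : g.Ψ.map star *ᵥ x.2 - g.Φ.map star *ᵥ star x.2 = -(g.den x *ᵥ star x.2) := by
      generalize star x.2 = w at *
      rw [hσ, den, Matrix.add_mulVec, Matrix.mulVec_neg, Matrix.mulVec_mulVec]
      abel
    rw [act_fst, e3, e2, Matrix.mulVec_sub, Matrix.mulVec_mulVec, hSS, Matrix.one_mulVec]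
    have e7 : (g.num x * (g.den x)⁻¹) *ᵥ (g.Ψ.map star *ᵥ x.2) -
        (g.num x * (g.den x)⁻¹) *ᵥ (g.Φ.map star *ᵥ star x.2) = -(g.num x *ᵥ star x.2) := by
      rw [← Matrix.mulVec_sub, e6, Matrix.mulVec_neg, e4]
    simp only [Matrix.mulVec_add] at e5 ⊢
    linear_combination (norm := module) e5 - e7

end AffSympComp

open Filter Topology

/-! ### The compact model as a set of uniqueness -/

section RealPoints

/-- A holomorphic function that vanishes at the real points near a real point vanishes near this
point. The real points are the fixed points of the conjugation `c`. -/
theorem eventually_eq_zero_of_real_points {V : Type*} [NormedAddCommGroup V] [NormedSpace ℂ V]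
    (c : V → V) (hc : Continuous c) (hadd : ∀ x y, c (x + y) = c x + c y)
    (hsmul : ∀ (a : ℂ) x, c (a • x) = star a • c x) (hinv : ∀ x, c (c x) = x)
    {H : V → ℂ} {y₀ : V} (hy₀ : c y₀ = y₀) (hH : AnalyticAt ℂ H y₀)
    (h0 : ∀ᶠ y in 𝓝 y₀, c y = y → H y = 0) : ∀ᶠ y in 𝓝 y₀, H y = 0 := by
  obtain ⟨r, hr, hball⟩ := Metric.eventually_nhds_iff_ball.1 (hH.eventually_analyticAt.and h0)
  -- Real and imaginary parts, z = u + iv with u and v fixed by the conjugation. On the complex line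
  -- t ↦ u + tv, real t give real points and t = i gives z.
  set u : V → V := fun z => (1 / 2 : ℂ) • (z + c z) with hu
  set v : V → V := fun z => (-Complex.I / 2) • (z - c z) with hv
  have huc : Continuous u := by fun_prop
  have hu0 : u y₀ = y₀ := by
    simp only [hu, hy₀]; module
  have hcneg : ∀ z, c (-z) = -c z := fun z => by
    rw [← neg_one_smul ℂ z, hsmul]; simp
  have hcu : ∀ z, c (u z) = u z := fun z => by
    simp only [hu, hsmul, hadd, hinv]
    simp [add_comm]
  have hcv : ∀ z, c (v z) = v z := fun z => by
    simp only [hv, hsmul, sub_eq_add_neg, hadd, hcneg, hinv]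
    have : star (-Complex.I / 2) = Complex.I / 2 := by simp
    rw [this]; module
  have huv : ∀ z, u z + Complex.I • v z = z := fun z => by
    simp only [hu, hv, smul_smul]
    rw [show Complex.I * (-Complex.I / 2) = 1 / 2 by
      rw [mul_div_assoc', mul_neg, Complex.I_mul_I]; norm_num]
    module
  have h1 : ∀ᶠ z in 𝓝 y₀, u z ∈ Metric.ball y₀ r :=
    huc.continuousAt.eventually (by rw [hu0]; exact Metric.ball_mem_nhds _ hr)
  filter_upwards [h1, Metric.ball_mem_nhds y₀ hr] with z hz1 hz2
  let D : Set ℂ := {t | u z + t • v z ∈ Metric.ball y₀ r}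
  have hline : Continuous fun t : ℂ => u z + t • v z := by fun_prop
  have hDo : IsOpen D := Metric.isOpen_ball.preimage hline
  -- Convexity of the ball makes the parameter domain connected, so the identity theorem reaches
  -- from 0 to i.
  have hDc : Convex ℝ D := by
    intro s hs t ht a b ha hb hab
    have : u z + (a • s + b • t) • v z = a • (u z + s • v z) + b • (u z + t • v z) := by
      have e : u z = (a + b) • u z := by rw [hab, one_smul]
      nth_rewrite 1 [e]
      simp only [add_smul, smul_add, smul_assoc]
      abel
    change u z + (a • s + b • t) • v z ∈ Metric.ball y₀ r
    rw [this]
    exact convex_ball y₀ r hs ht ha hb hab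
  have hD0 : (0 : ℂ) ∈ D := by simpa [D] using hz1
  have hDI : Complex.I ∈ D := by
    change u z + Complex.I • v z ∈ Metric.ball y₀ r
    rwa [huv]
  have hf : AnalyticOnNhd ℂ (fun t : ℂ => H (u z + t • v z)) D := by
    intro t ht
    have hl : AnalyticAt ℂ (fun t : ℂ => u z + t • v z) t := by fun_prop
    exact AnalyticAt.comp (g := H) (f := fun t : ℂ => u z + t • v z) (hball _ ht).1 hl
  have hfreq : ∃ᶠ t in 𝓝[≠] (0 : ℂ), H (u z + t • v z) = 0 := by
    have ht : Tendsto (fun s : ℝ => (s : ℂ)) (𝓝[≠] 0) (𝓝[≠] 0) := by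
      refine tendsto_nhdsWithin_iff.2 ⟨?_, ?_⟩
      · exact (Complex.continuous_ofReal.tendsto' 0 0 (by simp)).mono_left nhdsWithin_le_nhds
      · exact eventually_mem_nhdsWithin.mono fun s hs => by simpa using hs
    refine ht.frequently (Eventually.frequently ?_)
    have hD' : ∀ᶠ s : ℝ in 𝓝[≠] 0, (s : ℂ) ∈ D :=
      (ht.mono_right nhdsWithin_le_nhds).eventually (hDo.mem_nhds hD0)
    filter_upwards [hD'] with s hs
    refine (hball _ hs).2 ?_
    rw [hadd (u z), hsmul _ (v z), hcu, hcv]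
    simp
  have h2 : H (u z + Complex.I • v z) = 0 :=
    hf.eqOn_zero_of_preconnected_of_frequently_eq_zero hDc.isPreconnected hD0 hfreq hDI
  rwa [huv] at h2

end RealPoints

section CayleyTransform

variable {n : ℕ}

/-- Complex conjugation of the coordinates. -/
noncomputable def SymmAff.conj (y : SymmAff n ℂ) : SymmAff n ℂ :=
  (⟨(y.1 : Matrix (Fin n) (Fin n) ℂ).map star, by
    change Matrix.IsSymm _
    rw [Matrix.IsSymm, ← Matrix.transpose_map, show (y.1 : Matrix (Fin n) (Fin n) ℂ)ᵀ = y.1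
      from y.1.2]⟩, star y.2)

/-- The matrix `1 - iX`. -/
noncomputable def cayleyDen (y : SymmAff n ℂ) : Matrix (Fin n) (Fin n) ℂ :=
  1 - Complex.I • (y.1 : Matrix (Fin n) (Fin n) ℂ)

theorem cayleyDen_isSymm (y : SymmAff n ℂ) : (cayleyDen y).IsSymm :=
  Matrix.isSymm_one.sub (Matrix.IsSymm.smul y.1.2 _)

/-- The Cayley transform `(X, ξ) ↦ (ω(1 + iX)(1 - iX)⁻¹, iθ(1 - iX)⁻¹ξ)`, `ω = θ²`, which carries
real points into the compact model if `|θ| = 1`. -/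
noncomputable def cayley (θ : ℂ) (y : SymmAff n ℂ) : SymmAff n ℂ :=
  (⟨θ ^ 2 • ((2 : ℂ) • (cayleyDen y)⁻¹ - 1),
    (((cayleyDen_isSymm y).inv.smul _).sub Matrix.isSymm_one).smul _⟩,
    (Complex.I * θ) • ((cayleyDen y)⁻¹ *ᵥ y.2))

/-- The inverse Cayley transform
`(S, σ) ↦ (i(2ω(S + ω)⁻¹ - 1), -2iθ(S + ω)⁻¹σ)`, `ω = θ²`. -/
noncomputable def cayleyInv (θ : ℂ) (x : SymmAff n ℂ) : SymmAff n ℂ :=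
  (⟨Complex.I • ((2 * θ ^ 2) • ((x.1 : Matrix (Fin n) (Fin n) ℂ) + θ ^ 2 • 1)⁻¹ - 1),
    ((((Matrix.IsSymm.add x.1.2 (Matrix.isSymm_one.smul _)).inv).smul _).sub
      Matrix.isSymm_one).smul _⟩,
    (-2 * Complex.I * θ) • (((x.1 : Matrix (Fin n) (Fin n) ℂ) + θ ^ 2 • 1)⁻¹ *ᵥ x.2))

variable {θ : ℂ} {x y : SymmAff n ℂ}

theorem cayleyDen_cayleyInv : cayleyDen (cayleyInv θ x) =
    (2 * θ ^ 2) • ((x.1 : Matrix (Fin n) (Fin n) ℂ) + θ ^ 2 • 1)⁻¹ := by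
  simp only [cayleyDen, cayleyInv, smul_smul, Complex.I_mul_I]
  module

theorem inv_cayleyDen_cayleyInv (hθ : θ ≠ 0)
    (hx : ((x.1 : Matrix (Fin n) (Fin n) ℂ) + θ ^ 2 • 1).det ≠ 0) :
    (cayleyDen (cayleyInv θ x))⁻¹ =
      (2 * θ ^ 2)⁻¹ • ((x.1 : Matrix (Fin n) (Fin n) ℂ) + θ ^ 2 • 1) := by
  rw [cayleyDen_cayleyInv]
  refine Matrix.inv_eq_right_inv ?_
  rw [Matrix.smul_mul, Matrix.mul_smul, Matrix.nonsing_inv_mul _ (isUnit_iff_ne_zero.2 hx),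
    smul_smul, mul_inv_cancel₀ (by simpa using hθ), one_smul]

theorem cayley_cayleyInv (hθ : θ ≠ 0)
    (hx : ((x.1 : Matrix (Fin n) (Fin n) ℂ) + θ ^ 2 • 1).det ≠ 0) :
    cayley θ (cayleyInv θ x) = x := by
  refine Prod.ext (Subtype.ext ?_) ?_
  · simp only [cayley, inv_cayleyDen_cayleyInv hθ hx, smul_sub, smul_add, smul_smul]
    have : θ ^ 2 * (2 * (2 * θ ^ 2)⁻¹) = 1 := by field_simp
    rw [this]
    have : θ ^ 2 * (2 * ((2 * θ ^ 2)⁻¹ * θ ^ 2)) = θ ^ 2 := by field_simp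
    rw [this]
    module
  · simp only [cayley, inv_cayleyDen_cayleyInv hθ hx]
    simp only [cayleyInv, Matrix.mulVec_smul, smul_smul, Matrix.mulVec_mulVec]
    rw [Matrix.smul_mul, Matrix.mul_nonsing_inv _ (isUnit_iff_ne_zero.2 hx), Matrix.smul_mulVec,
      Matrix.one_mulVec, smul_smul]
    have : Complex.I * θ * (-2 * Complex.I * θ) * (2 * θ ^ 2)⁻¹ = 1 := by
      field_simp
      simp
    rw [this, one_smul]

theorem cayley_mem_compactModel (hθ : star θ * θ = 1) (hy : SymmAff.conj y = y)
    (hd : (cayleyDen y).det ≠ 0) : cayley θ y ∈ compactModel n := by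
  have hX : (y.1 : Matrix (Fin n) (Fin n) ℂ).map star = y.1 :=
    congrArg (fun z : SymmAff n ℂ => (z.1 : Matrix (Fin n) (Fin n) ℂ)) hy
  have hξ : star y.2 = y.2 := congrArg Prod.snd hy
  set A := cayleyDen y with hA
  have hAc : A.map star = (2 : ℂ) • 1 - A := by
    have : A.map star = 1 + Complex.I • (y.1 : Matrix (Fin n) (Fin n) ℂ) := by
      conv_rhs => rw [← hX]
      ext i j
      by_cases hij : i = j <;> simp [hA, cayleyDen, hij]
    rw [this, hA, cayleyDen]
    module
  have hu : IsUnit A.det := isUnit_iff_ne_zero.2 hd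
  have hu' : IsUnit (A.map star).det := by
    rw [Matrix.det_map_star]; exact isUnit_iff_ne_zero.2 (star_ne_zero.2 hd)
  have hinv : (A⁻¹).map star = (A.map star)⁻¹ := by
    refine (Matrix.inv_eq_right_inv ?_).symm
    rw [← Matrix.map_star_mul, Matrix.mul_nonsing_inv _ hu, Matrix.map_star_one]
  have hS : (2 : ℂ) • A⁻¹ - 1 = A.map star * A⁻¹ := by
    rw [hAc, sub_mul, Matrix.smul_mul, one_mul, Matrix.mul_nonsing_inv _ hu]
  have hcomm : A.map star * A⁻¹ = A⁻¹ * A.map star := by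
    rw [hAc, sub_mul, mul_sub, Matrix.mul_nonsing_inv _ hu, Matrix.nonsing_inv_mul _ hu,
      Matrix.smul_mul, Matrix.mul_smul, one_mul, mul_one]
  have hfst : ((cayley θ y).1 : Matrix (Fin n) (Fin n) ℂ) = θ ^ 2 • (A.map star * A⁻¹) := by
    rw [← hS]; rfl
  have hsmul : ∀ (a : ℂ) (B : Matrix (Fin n) (Fin n) ℂ),
      (a • B).map star = star a • B.map star := fun a B => by
    ext i j; simp
  refine AffSympComp.mem_compactModel_iff.2 ⟨?_, ?_⟩
  · rw [hfst, hsmul, Matrix.map_star_mul, Matrix.map_star_map_star, hinv, Matrix.smul_mul,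
      Matrix.mul_smul, smul_smul, mul_assoc, Matrix.nonsing_inv_mul_cancel_left _ _ hu,
      Matrix.mul_nonsing_inv _ hu', star_pow, ← mul_pow, mul_comm θ, hθ, one_pow, one_smul]
  · have hsnd : (cayley θ y).2 = (Complex.I * θ) • (A⁻¹ *ᵥ y.2) := rfl
    rw [hfst, hsnd, star_smul, Matrix.star_mulVec_eq, hξ, hinv, Matrix.mulVec_smul,
      Matrix.smul_mulVec, Matrix.mulVec_mulVec, hcomm, Matrix.mul_nonsing_inv_cancel_right _ _ hu',
      smul_smul, ← neg_smul]
    congr 1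
    have : star (Complex.I * θ) = -Complex.I * star θ := by simp
    rw [this]
    linear_combination (-Complex.I * θ) * hθ

theorem conj_cayleyInv (hθ : star θ * θ = 1) (hx : x ∈ compactModel n)
    (hd : ((x.1 : Matrix (Fin n) (Fin n) ℂ) + θ ^ 2 • 1).det ≠ 0) :
    SymmAff.conj (cayleyInv θ x) = cayleyInv θ x := by
  obtain ⟨hS, hσ⟩ := AffSympComp.mem_compactModel_iff.1 hx
  set S : Matrix (Fin n) (Fin n) ℂ := (x.1 : Matrix (Fin n) (Fin n) ℂ) with hSdef
  have hu := isUnit_iff_ne_zero.2 hd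
  set B := S + θ ^ 2 • (1 : Matrix (Fin n) (Fin n) ℂ) with hB
  have hsmul : ∀ (a : ℂ) (B : Matrix (Fin n) (Fin n) ℂ),
      (a • B).map star = star a • B.map star := fun a B => by
    ext i j; simp
  have hBc : B.map star = (star θ ^ 2) • (S.map star * B) := by
    rw [hB, mul_add, mul_eq_one_comm.1 hS, Matrix.map_star_add, hsmul, Matrix.map_star_one,
      Matrix.mul_smul, mul_one, smul_add, smul_smul, ← mul_pow, hθ, one_pow, one_smul, star_pow,
      add_comm]
  have hBi : (B⁻¹).map star = θ ^ 2 • (B⁻¹ * S) := by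
    have h1 : B.map star * (θ ^ 2 • (B⁻¹ * S)) = 1 := by
      rw [hBc, Matrix.smul_mul, Matrix.mul_smul, smul_smul, ← mul_pow, hθ, one_pow, one_smul,
        mul_assoc, Matrix.mul_nonsing_inv_cancel_left _ _ hu, mul_eq_one_comm.1 hS]
    rw [← Matrix.inv_eq_right_inv h1]
    refine (Matrix.inv_eq_right_inv ?_).symm
    rw [← Matrix.map_star_mul, Matrix.mul_nonsing_inv _ hu, Matrix.map_star_one]
  have hBS : B⁻¹ * S = 1 - θ ^ 2 • B⁻¹ := by
    have : S = B - θ ^ 2 • 1 := by rw [hB]; abel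
    rw [this, mul_sub, Matrix.nonsing_inv_mul _ hu, Matrix.mul_smul, mul_one]
  have hθ2 : star θ ^ 2 * θ ^ 2 = 1 := by rw [← mul_pow, hθ, one_pow]
  refine Prod.ext (Subtype.ext ?_) ?_
  · change (Complex.I • ((2 * θ ^ 2) • B⁻¹ - 1)).map star = Complex.I • ((2 * θ ^ 2) • B⁻¹ - 1)
    have h1 : ((2 * θ ^ 2) • B⁻¹ - 1).map star = (2 : ℂ) • (B⁻¹ * S) - 1 := by
      have hneg : (-1 : Matrix (Fin n) (Fin n) ℂ).map star = -1 := by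
        ext i j; by_cases hij : i = j <;> simp [hij]
      rw [sub_eq_add_neg, Matrix.map_star_add, hsmul, hBi, hneg, smul_smul, ← sub_eq_add_neg]
      congr 2
      simp only [star_mul', star_pow, star_ofNat]
      linear_combination 2 * hθ2
    rw [hsmul, h1, hBS]
    simp only [Complex.star_def, Complex.conj_I]
    module
  · change star ((-2 * Complex.I * θ) • (B⁻¹ *ᵥ x.2)) = (-2 * Complex.I * θ) • (B⁻¹ *ᵥ x.2)
    rw [star_smul, Matrix.star_mulVec_eq, hBi, Matrix.smul_mulVec, ← Matrix.mulVec_mulVec]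
    have h2 : S *ᵥ star x.2 = -x.2 := by
      nth_rewrite 2 [hσ]; rw [neg_neg]
    rw [h2, Matrix.mulVec_neg, smul_smul, smul_neg, ← neg_smul]
    congr 1
    have : star (-2 * Complex.I * θ) = 2 * Complex.I * star θ := by simp
    rw [this]
    linear_combination (-2 * Complex.I * θ) * hθ

/-- The unit circle is infinite and the spectrum finite. The choice of θ places the given point
inside the domain of the inverse Cayley transform; choosing a square root of ω rather than ω is
needed for the factor iθ in the vector component. -/
theorem Matrix.exists_star_mul_self_eq_one_det_add_sq_ne_zero (S : Matrix (Fin n) (Fin n) ℂ) :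
    ∃ θ : ℂ, star θ * θ = 1 ∧ (S + θ ^ 2 • (1 : Matrix (Fin n) (Fin n) ℂ)).det ≠ 0 := by
  have hinf : (Metric.sphere (0 : ℂ) 1).Infinite := by
    have hconn := isPreconnected_sphere (E := ℂ) (by rw [Complex.rank_real_complex]; norm_num) 0 1
    exact hconn.infinite_of_nontrivial ⟨1, by simp, -1, by simp, by norm_num⟩
  obtain ⟨μ, hμ, hμS⟩ := hinf.exists_notMem_finite S.finite_spectrum
  obtain ⟨θ, hθ⟩ := IsAlgClosed.exists_pow_nat_eq (-μ) (n := 2) (by norm_num)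
  refine ⟨θ, ?_, fun h => hμS ?_⟩
  · have hn : ‖θ‖ ^ 2 = 1 := by
      rw [← norm_pow, hθ, norm_neg]; simpa using hμ
    rw [Complex.star_def, Complex.conj_mul', ← Complex.ofReal_pow, hn, Complex.ofReal_one]
  · rw [spectrum.mem_iff, Matrix.isUnit_iff_isUnit_det, isUnit_iff_ne_zero, not_not]
    have : algebraMap ℂ (Matrix (Fin n) (Fin n) ℂ) μ - S = -(S + θ ^ 2 • 1) := by
      rw [Algebra.algebraMap_eq_smul_one, hθ]; module
    rw [this, Matrix.det_neg, h, mul_zero]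

theorem contDiffAt_cayleyDen {k : ℕ∞ω} : ContDiffAt ℂ k
    (fun y : SymmAff n ℂ => cayleyDen y) y :=
  contDiffAt_const.sub (AffSymp.contDiffAt_coe_fst.const_smul _)

theorem contDiffAt_cayley {k : ℕ∞ω} (hy : (cayleyDen y).det ≠ 0) :
    ContDiffAt ℂ k (cayley θ : SymmAff n ℂ → SymmAff n ℂ) y := by
  have h := (contDiffAt_cayleyDen (k := k)).matrix_inv hy
  exact ContDiffAt.prodMk (AffSymp.contDiffAt_subtype_iff.2
    (((h.const_smul _).sub contDiffAt_const).const_smul _))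
    ((h.matrix_mulVec contDiffAt_snd).const_smul _)

theorem contDiffAt_cayleyInv {k : ℕ∞ω}
    (hx : ((x.1 : Matrix (Fin n) (Fin n) ℂ) + θ ^ 2 • 1).det ≠ 0) :
    ContDiffAt ℂ k (cayleyInv θ : SymmAff n ℂ → SymmAff n ℂ) x := by
  have h : ContDiffAt ℂ k (fun x : SymmAff n ℂ =>
      ((x.1 : Matrix (Fin n) (Fin n) ℂ) + θ ^ 2 • 1)⁻¹) x :=
    (AffSymp.contDiffAt_coe_fst.add contDiffAt_const).matrix_inv hx
  exact ContDiffAt.prodMk (AffSymp.contDiffAt_subtype_iff.2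
    (((h.const_smul _).sub contDiffAt_const).const_smul _))
    ((h.matrix_mulVec contDiffAt_snd).const_smul _)

/-- The compact model is a set of uniqueness for holomorphic functions. -/
theorem eventually_eq_zero_of_eventually_mem_compactModel {H : SymmAff n ℂ → ℂ}
    (hx : x ∈ compactModel n) (hH : AnalyticAt ℂ H x)
    (h0 : ∀ᶠ z in 𝓝 x, z ∈ compactModel n → H z = 0) : ∀ᶠ z in 𝓝 x, H z = 0 := by
  obtain ⟨θ, hθ, hd⟩ := Matrix.exists_star_mul_self_eq_one_det_add_sq_ne_zero
    (x.1 : Matrix (Fin n) (Fin n) ℂ)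
  have hθ0 : θ ≠ 0 := right_ne_zero_of_mul_eq_one hθ
  have hcx : cayley θ (cayleyInv θ x) = x := cayley_cayleyInv hθ0 hd
  have hden : (cayleyDen (cayleyInv θ x)).det ≠ 0 := by
    rw [cayleyDen_cayleyInv, Matrix.det_smul, Matrix.det_nonsing_inv, Ring.inverse_eq_inv']
    exact mul_ne_zero (pow_ne_zero _ (by simpa using hθ0)) (inv_ne_zero hd)
  have hcay : AnalyticAt ℂ (cayley θ : SymmAff n ℂ → SymmAff n ℂ) (cayleyInv θ x) :=
    (contDiffAt_cayley (k := ω) hden).analyticAt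
  -- In the Cayley chart, points of the model become points fixed by complex conjugation, and the
  -- uniqueness statement for real points applies to the pulled-back function.
  have hcomp : AnalyticAt ℂ (H ∘ cayley θ) (cayleyInv θ x) := hH.comp_of_eq hcay hcx
  have hconj : Continuous (SymmAff.conj : SymmAff n ℂ → SymmAff n ℂ) := by
    have h1 : Continuous fun y : SymmAff n ℂ => (y.1 : Matrix (Fin n) (Fin n) ℂ) :=
      continuous_iff_continuousAt.2 fun y =>
        (AffSymp.contDiffAt_coe_fst (𝕜 := ℂ) (k := 0) (x := y)).continuousAt
    refine Continuous.prodMk (continuous_induced_rng.2 ?_) continuous_snd.star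
    exact continuous_pi fun i => continuous_pi fun j =>
      ((continuous_apply_apply i j).comp h1).star
  have hmain := eventually_eq_zero_of_real_points SymmAff.conj hconj ?_ ?_ ?_
    (conj_cayleyInv hθ hx hd) hcomp ?_
  · have hback := (contDiffAt_cayleyInv (k := 0) hd).continuousAt.eventually hmain
    have hdet := ((AffSymp.contDiffAt_coe_fst (k := 0) (x := x)).add
      (contDiffAt_const (c := θ ^ 2 • (1 : Matrix (Fin n) (Fin n) ℂ)))).matrix_det
    have hne := hdet.continuousAt.eventually_ne hd
    filter_upwards [hback, hne] with z hz hzd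
    rw [← cayley_cayleyInv hθ0 hzd]
    exact hz
  · intro y z
    refine Prod.ext (Subtype.ext ?_) ?_
    · ext i j; simp [SymmAff.conj]
    · simp [SymmAff.conj]
  · intro a y
    refine Prod.ext (Subtype.ext ?_) ?_
    · ext i j; simp [SymmAff.conj]
    · simp [SymmAff.conj]
  · intro y
    refine Prod.ext (Subtype.ext ?_) ?_
    · ext i j; simp [SymmAff.conj]
    · simp [SymmAff.conj]
  · have hdet := (contDiffAt_cayleyDen (k := 0) (y := cayleyInv θ x)).matrix_det
    have hde := hdet.continuousAt.eventually_ne hden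
    have hev : ∀ᶠ y in 𝓝 (cayleyInv θ x), cayley θ y ∈ compactModel n → H (cayley θ y) = 0 :=
      hcay.continuousAt.eventually (by rw [hcx]; exact h0)
    filter_upwards [hde, hev] with y hy1 hy2 hyc
    exact hy2 (cayley_mem_compactModel hθ hyc hy1)

end CayleyTransform

/-! ### Branches of the inverse square root -/

section InvSqrt

/-- The principal branch of `z ^ (-1/2)`. -/
noncomputable def invSqrt (z : ℂ) : ℂ :=
  Complex.exp (-Complex.log z / 2)

theorem invSqrt_sq_mul {z : ℂ} (hz : z ≠ 0) : invSqrt z ^ 2 * z = 1 := by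
  have h : invSqrt z ^ 2 = z⁻¹ := by
    rw [invSqrt, ← Complex.exp_nat_mul]
    nth_rewrite 2 [← Complex.exp_log hz]
    rw [← Complex.exp_neg]
    congr 1
    push_cast
    ring
  rw [h, inv_mul_cancel₀ hz]

theorem contDiffAt_invSqrt {z : ℂ} {k : ℕ∞ω} (hz : z ∈ Complex.slitPlane) :
    ContDiffAt ℂ k invSqrt z :=
  ((Complex.contDiffAt_log hz).neg.div_const 2).cexp

theorem invSqrt_ofReal_sq {r : ℝ} (hr : 0 < r) : invSqrt ((r : ℂ) ^ 2) = ((r⁻¹ : ℝ) : ℂ) := by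
  rw [invSqrt, ← Complex.ofReal_pow, ← Complex.ofReal_log (by positivity), Real.log_pow]
  have : -((((2 : ℕ) : ℝ) * Real.log r : ℝ) : ℂ) / 2 = ((-Real.log r : ℝ) : ℂ) := by
    push_cast
    ring
  rw [this, ← Complex.ofReal_exp, Real.exp_neg, Real.exp_log hr]

/-- A function that is continuous at a point and whose square is `1` is locally constant there. -/
theorem eventually_eq_of_sq_eq_one {X : Type*} [TopologicalSpace X] {ρ : X → ℂ} {x : X}
    (hc : ContinuousAt ρ x) (h : ∀ᶠ y in 𝓝 x, ρ y ^ 2 = 1) : ∀ᶠ y in 𝓝 x, ρ y = ρ x := by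
  have hx := h.self_of_nhds
  have hne : ρ x + ρ x ≠ 0 := by
    rw [← two_mul]
    exact mul_ne_zero two_ne_zero fun h0 => by simp [h0] at hx
  filter_upwards [h, (hc.add_const (ρ x)).eventually_ne hne] with y hy hy'
  have : (ρ y + ρ x) * (ρ y - ρ x) = 0 := by linear_combination hy - hx
  exact sub_eq_zero.1 ((mul_eq_zero.1 this).resolve_left hy')

end InvSqrt

/-! ### Covariance of the compact system -/

namespace AffSympComp

variable {n : ℕ} (g : AffSympComp n) {x : SymmAff n ℂ} {k : ℕ∞ω}

/-- The holomorphic continuation `det(ΦS + Ψ) det(Ψ'S + Φ') det(S)⁻¹` of `|det(Ψ'S + Φ')|²`. -/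
noncomputable def normSqDet (x : SymmAff n ℂ) : ℂ :=
  (g.num x).det * (g.den x).det * (x.1 : Matrix (Fin n) (Fin n) ℂ).det⁻¹

theorem normSqDet_of_mem (hx : x ∈ compactModel n) :
    g.normSqDet x = (‖g.toAffSymp.autDet x‖ : ℂ) ^ 2 := by
  rw [normSqDet, g.det_num hx, ← Complex.conj_mul', g.autDet_eq, mul_right_comm, mul_assoc (star _),
    mul_inv_cancel₀ (det_ne_zero_of_mem hx), mul_one]
  rfl

theorem contDiffAt_det_fst :
    ContDiffAt ℂ k (fun y : SymmAff n ℂ => (y.1 : Matrix (Fin n) (Fin n) ℂ).det) x :=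
  AffSymp.contDiffAt_coe_fst.matrix_det

theorem contDiffAt_normSqDet (hx : (x.1 : Matrix (Fin n) (Fin n) ℂ).det ≠ 0) :
    ContDiffAt ℂ k g.normSqDet x := by
  have h : ContDiffAt ℂ k (fun y : SymmAff n ℂ => (g.num y).det) x :=
    ((contDiffAt_const.matrix_mul AffSymp.contDiffAt_coe_fst).add contDiffAt_const).matrix_det
  exact (h.mul (AffSymp.contDiffAt_autDet (g := g.toAffSymp))).mul (contDiffAt_det_fst.inv hx)

/-- The holomorphic continuation of `ρ_comp(g)f`, for a holomorphic continuation `G` of `f`. -/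
noncomputable def rhoCont (G : SymmAff n ℂ → ℂ) (x : SymmAff n ℂ) : ℂ :=
  G (g.toAffSymp.act x) * invSqrt (g.normSqDet x)

/-- The points where `rhoCont` is defined and holomorphic if `G` is holomorphic on `O`. -/
def contDomain (O : Set (SymmAff n ℂ)) : Set (SymmAff n ℂ) :=
  {x | x ∈ g.toAffSymp.domain O ∧ (x.1 : Matrix (Fin n) (Fin n) ℂ).det ≠ 0 ∧
    g.normSqDet x ∈ Complex.slitPlane}

variable {g} {O Ω : Set (SymmAff n ℂ)} {f G : SymmAff n ℂ → ℂ}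

theorem isOpen_contDomain (hO : IsOpen O) : IsOpen (g.contDomain O) := by
  rw [isOpen_iff_mem_nhds]
  rintro x ⟨hx1, hx2, hx3⟩
  filter_upwards [(AffSymp.isOpen_domain hO).mem_nhds hx1,
    (contDiffAt_det_fst (k := 0)).continuousAt.eventually_ne hx2,
    (g.contDiffAt_normSqDet (k := 0) hx2).continuousAt.eventually
      (Complex.isOpen_slitPlane.mem_nhds hx3)] with y h1 h2 h3 using ⟨h1, h2, h3⟩

theorem analyticOnNhd_rhoCont (hG : AnalyticOnNhd ℂ G O) :
    AnalyticOnNhd ℂ (g.rhoCont G) (g.contDomain O) := by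
  rintro x ⟨⟨hx1, hx2⟩, hx3, hx4⟩
  refine ContDiffAt.analyticAt (𝕜 := ℂ) ?_
  exact ((hG _ hx2).contDiffAt.comp x (AffSymp.contDiffAt_act hx1)).mul
    ((contDiffAt_invSqrt hx4).comp x (g.contDiffAt_normSqDet hx3))

/-- On the model the continued |det|² is a positive real number, so it avoids the cut of the
principal branch. -/
theorem mem_contDomain_of_mem (hx : x ∈ compactModel n) (hxO : g.toAffSymp.act x ∈ O) :
    x ∈ g.contDomain O := by
  refine ⟨⟨g.autDet_ne_zero hx, hxO⟩, det_ne_zero_of_mem hx, ?_⟩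
  rw [g.normSqDet_of_mem hx, ← Complex.ofReal_pow, Complex.ofReal_mem_slitPlane]
  exact pow_pos (norm_pos_iff.2 (g.autDet_ne_zero hx)) 2

theorem rhoCont_eq_rhoComp (hx : x ∈ compactModel n)
    (hGf : G (g.toAffSymp.act x) = f (g.toAffSymp.act x)) : g.rhoCont G x = g.rhoComp f x := by
  rw [rhoCont, rhoComp, g.normSqDet_of_mem hx,
    invSqrt_ofReal_sq (norm_pos_iff.2 (g.autDet_ne_zero hx)), hGf]

/-- Near every point where `det S ≠ 0` there is a holomorphic branch of `det(S)^(-1/2)`. -/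
theorem exists_branch (hO : IsOpen O) (hx : x ∈ O)
    (hd : ∀ y ∈ O, (y.1 : Matrix (Fin n) (Fin n) ℂ).det ≠ 0) :
    ∃ V ⊆ O, IsOpen V ∧ x ∈ V ∧ ∃ ψ : SymmAff n ℂ → ℂ, AnalyticOnNhd ℂ ψ V ∧
      ∀ y ∈ V, ψ y ^ 2 * (y.1 : Matrix (Fin n) (Fin n) ℂ).det = 1 := by
  set d₀ := (x.1 : Matrix (Fin n) (Fin n) ℂ).det with hd₀
  have hd₀0 : d₀ ≠ 0 := hd x hx
  have hquot : ∀ y : SymmAff n ℂ, ContDiffAt ℂ ω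
      (fun y : SymmAff n ℂ => (y.1 : Matrix (Fin n) (Fin n) ℂ).det / d₀) y :=
    fun y => contDiffAt_det_fst.div_const d₀
  -- Dividing by the value at `x` moves the base value to 1, away from the cut; the constant factor
  -- `invSqrt d₀` restores the normalization.
  refine ⟨O ∩ (fun y : SymmAff n ℂ => (y.1 : Matrix (Fin n) (Fin n) ℂ).det / d₀) ⁻¹'
      Complex.slitPlane, Set.inter_subset_left,
    hO.inter (Complex.isOpen_slitPlane.preimage
      (continuous_iff_continuousAt.2 fun y => (hquot y).continuousAt)), ⟨hx, ?_⟩,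
    fun y => invSqrt ((y.1 : Matrix (Fin n) (Fin n) ℂ).det / d₀) * invSqrt d₀, ?_, ?_⟩
  · simp [← hd₀, div_self hd₀0]
  · rintro y ⟨-, hy⟩
    exact (((contDiffAt_invSqrt hy).comp y (hquot y)).mul contDiffAt_const).analyticAt
  · rintro y ⟨hy, -⟩
    have h1 := invSqrt_sq_mul (div_ne_zero (hd y hy) hd₀0)
    have h2 := invSqrt_sq_mul hd₀0
    calc _ = (invSqrt ((y.1 : Matrix (Fin n) (Fin n) ℂ).det / d₀) ^ 2 *
          ((y.1 : Matrix (Fin n) (Fin n) ℂ).det / d₀)) * (invSqrt d₀ ^ 2 * d₀) := by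
          field_simp
      _ = 1 := by rw [h1, h2, one_mul]

/-- Covariance of the system `𝔇_comp`. -/
theorem solvesComp_of_eventuallyEq_rhoCont (hO : IsOpen O) (hG : AnalyticOnNhd ℂ G O)
    (hs : SolvesComp O G) {D : Set (SymmAff n ℂ)} {F : SymmAff n ℂ → ℂ}
    (hD : D ⊆ g.contDomain O) (hF : ∀ x ∈ D, F =ᶠ[𝓝 x] g.rhoCont G) : SolvesComp D F := by
  refine ⟨fun x hx => (hD hx).2.1, fun V hVD hV φ hφ hφ2 I J x hx => ?_⟩
  obtain ⟨⟨hx1, hx2⟩, hx3, hx4⟩ := hD (hVD hx)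
  obtain ⟨V', hV'O, hV', hxV', ψ, hψ, hψ2⟩ := exists_branch hO hx2 hs.1
  have hact := AffSymp.contDiffAt_act (k := 0) hx1
  -- The ratio between φ times the continued factor and the flat factor det(Ψ̄S + Φ̄)⁻¹ times ψ at
  -- the image point. Both have square 1/(det(ΦS + Ψ) det(Ψ̄S + Φ̄)), so the ratio is ±1, and by
  -- continuity it is locally constant.
  set ρ : SymmAff n ℂ → ℂ := fun y =>
    φ y * invSqrt (g.normSqDet y) * g.toAffSymp.autDet y * (ψ (g.toAffSymp.act y))⁻¹ with hρ
  have hψ0 : ∀ y ∈ V', ψ y ≠ 0 := fun y hy h0 => by simpa [h0] using hψ2 y hy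
  have hev : ∀ᶠ y in 𝓝 x, y ∈ V ∧ y ∈ g.contDomain V' := 
    (hV.eventually_mem hx).and ((isOpen_contDomain hV').eventually_mem ⟨⟨hx1, hxV'⟩, hx3, hx4⟩)
  have hρc : ContinuousAt ρ x := by
    refine (((hφ x hx).continuousAt.mul ?_).mul
      (AffSymp.contDiffAt_autDet (k := 0)).continuousAt).mul (ContinuousAt.inv₀ ?_ (hψ0 _ hxV'))
    · exact ((contDiffAt_invSqrt (k := 0) hx4).comp x (g.contDiffAt_normSqDet hx3)).continuousAt
    · exact ContinuousAt.comp (hψ _ hxV').continuousAt hact.continuousAt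
  have hρ2 : ∀ᶠ y in 𝓝 x, ρ y ^ 2 = 1 := by
    filter_upwards [hev] with y hy
    obtain ⟨hyV, ⟨hy1, hy2⟩, hy3, hy4⟩ := hy
    have e1 := hφ2 y hyV
    have e2 := invSqrt_sq_mul (Complex.slitPlane_ne_zero hy4)
    have e3 := hψ2 _ hy2
    have h0 := hψ0 _ hy2
    rw [g.act_fst, Matrix.det_mul, Matrix.det_nonsing_inv, Ring.inverse_eq_inv'] at e3
    rw [normSqDet] at e2
    rw [g.autDet_eq] at hy1
    have hn : (g.num y).det ≠ 0 := fun h => by simp [h] at e3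
    simp only [hρ, g.autDet_eq, normSqDet, mul_pow, inv_pow]
    rw [mul_inv_eq_one₀ (pow_ne_zero 2 h0)]
    generalize ψ (g.toAffSymp.act y) = p at *
    generalize φ y = q at *
    generalize invSqrt _ = r at *
    field_simp at e1 e2 e3 ⊢
    refine mul_left_cancel₀ hn ?_
    linear_combination q ^ 2 * (g.den y).det * e2 + (g.den y).det * e1 - e3
  -- Flat covariance is applied to ψG, which solves the flat system because ψ is a branch of
  -- det(S)^(-1/2) near the image point.
  refine AffSymp.detMinor_eq_zero_of_eventuallyEq_transform (g := g.toAffSymp)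
    (G := fun y => ψ y * G y) hx1
    ((hψ _ hxV').contDiffAt.mul (hG _ hx2).contDiffAt)
    (fun I J => hs.2 V' hV'O hV' ψ hψ hψ2 I J _ hxV') (ρ x) ?_ I J
  filter_upwards [hev, hF x (hVD hx), eventually_eq_of_sq_eq_one hρc hρ2] with y hy hFy hρy
  obtain ⟨hyV, ⟨hy1, hy2⟩, hy3, hy4⟩ := hy
  have h0 := hψ0 _ hy2
  rw [← hρy, hFy]
  simp only [hρ, rhoCont, AffSymp.transform, smul_eq_mul]
  field_simp

theorem isCompSolution_rhoComp (g : AffSympComp n) (h : IsCompSolution Ω f) :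
    IsCompSolution {x ∈ compactModel n | g.toAffSymp.act x ∈ Ω} (g.rhoComp f) := by
  obtain ⟨⟨W, hW, hΩW⟩, ⟨O₁, G, hcont⟩, huniq⟩ := h
  obtain ⟨O, hO₁, hO, hΩO, hs⟩ := huniq O₁ G hcont
  have hG : AnalyticOnNhd ℂ G O := hcont.2.2.1.mono hO₁
  have hΩg : {x ∈ compactModel n | g.toAffSymp.act x ∈ Ω} =
      g.toAffSymp.domain W ∩ compactModel n := by
    ext x
    constructor
    · rintro ⟨hx, hxΩ⟩
      rw [hΩW] at hxΩ
      exact ⟨⟨g.autDet_ne_zero hx, hxΩ.1⟩, hx⟩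
    · rintro ⟨⟨-, hxW⟩, hx⟩
      exact ⟨hx, hΩW ▸ ⟨hxW, g.act_mem_compactModel hx⟩⟩
  have hsub : ∀ x ∈ {x ∈ compactModel n | g.toAffSymp.act x ∈ Ω}, x ∈ g.contDomain O :=
    fun x hx => mem_contDomain_of_mem hx.1 (hΩO hx.2)
  have heq : ∀ x ∈ {x ∈ compactModel n | g.toAffSymp.act x ∈ Ω}, g.rhoCont G x = g.rhoComp f x :=
    fun x hx => rhoCont_eq_rhoComp hx.1 (hcont.2.2.2 hx.2)
  refine ⟨⟨_, AffSymp.isOpen_domain hW, hΩg⟩, ⟨g.contDomain O, g.rhoCont G,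
    isOpen_contDomain hO, hsub, analyticOnNhd_rhoCont hG, heq⟩, ?_⟩
  rintro O₂ G₂ ⟨hO₂, hΩ₂, hG₂, hG₂f⟩
  -- For an arbitrary continuation `G₂`, the neighbourhood is the open set of points where its germ
  -- equals that of `rhoCont`. It contains the given part of the model by uniqueness.
  refine ⟨{x | x ∈ O₂ ∩ g.contDomain O ∧ G₂ =ᶠ[𝓝 x] g.rhoCont G}, fun x hx => hx.1.1, ?_,
    fun x hx => ⟨⟨hΩ₂ hx, hsub x hx⟩, ?_⟩,
    solvesComp_of_eventuallyEq_rhoCont hO hG hs (fun x hx => hx.1.2) fun x hx => hx.2⟩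
  · rw [isOpen_iff_mem_nhds]
    rintro x ⟨hx1, hx2⟩
    exact ((hO₂.inter (isOpen_contDomain hO)).eventually_mem hx1).and
      (eventually_eventually_nhds.2 hx2)
  · have han : AnalyticAt ℂ (fun y => G₂ y - g.rhoCont G y) x :=
      (hG₂ x (hΩ₂ hx)).sub (analyticOnNhd_rhoCont hG x (hsub x hx))
    have hxd : x ∈ g.toAffSymp.domain W ∩ compactModel n := hΩg ▸ hx
    have hzero := eventually_eq_zero_of_eventually_mem_compactModel hx.1 han
      (((AffSymp.isOpen_domain hW).eventually_mem hxd.1).mono fun y hy hyM => by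
        have hyΩ : y ∈ {x ∈ compactModel n | g.toAffSymp.act x ∈ Ω} := hΩg ▸ ⟨hy, hyM⟩
        rw [hG₂f hyΩ, heq y hyΩ, sub_self])
    exact hzero.mono fun y hy => sub_eq_zero.1 hy

end AffSympComp

theorem mainTheorem2 (n : ℕ) :
    (∀ (g : AffSymp n ℂ) (U : Set (SymmAff n ℂ)) (G : SymmAff n ℂ → ℂ),
      IsHolSolution U G → IsHolSolution (g.domain U) (g.transform G)) ∧
    (∀ (𝕂 : Type) [RCLike 𝕂] (g : AffSymp n ℝ) (U : Set (SymmAff n ℝ)) (G : SymmAff n ℝ → 𝕂),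
      IsSmoothSolution U G →
        IsSmoothSolution (g.domain U) (g.transform G) ∧
        IsSmoothSolution (g.domain U) (g.rhoFlat G)) ∧
    (∀ (g : AffSympComp n) (Ω : Set (SymmAff n ℂ)) (f : SymmAff n ℂ → ℂ),
      IsCompSolution Ω f →
        IsCompSolution {x ∈ compactModel n | g.toAffSymp.act x ∈ Ω} (g.rhoComp f)) := by
  refine ⟨fun g U G h => g.isHolSolution_transform h, fun 𝕂 _ g U G h => ⟨?_, ?_⟩,
    fun g Ω f h => ?_⟩
  · exact AffSymp.isSmoothSolution_of_eventuallyEq_transform g h fun x _ =>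
      ⟨1, by simp only [one_smul]; rfl⟩
  · exact AffSymp.isSmoothSolution_of_eventuallyEq_transform g h fun x hx =>
      g.rhoFlat_eventuallyEq G hx.1
  · exact g.isCompSolution_rhoComp h
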